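/- Let $(E,\mathcal E,m)$ be a $\sigma$-finite measure space and $L^1=L^1(E,\mathcal E,m)$ (real-valued functions). A linear operator on $L^1$ is stochastic if it maps $D(m)=\{u\in L^1:u\ge 0,\ \|u\|=1\}$ into itself. A substochastic (respectively stochastic) semigroup is a strongly continuous semigroup of positive contractions (respectively of stochastic operators) on $L^1$. A semigroup $\{S(t)\}_{t\ge0}$ is strongly stable if $\lim_{t\to\infty}S(t)u=0$ for all $u\in L^1$, and an operator $T$ on $L^1$ is mean ergodic if $\lim_{N\to\infty}\frac1N\sum_{n=0}^{N-1}T^nu$ exists in $L^1$ for all $u\in L^1$. Let $(A,\mathcal D(A))$ and $(B,\mathcal D(B))$ be linear operators in $L^1$ such that 1. $A$ is the generator of a substochastic semigroup $\{S(t)\}_{t\ge0}$; 2. $\mathcal D(A)\subseteq\mathcal D(B)$, and $Bu\ge0$ for every $u\in\mathcal D(A)$ with $u\ge0$; 3. $\int_E(Au+Bu)\,dm=0$ for every $u\in\mathcal D(A)$ with $u\ge0$. Then every $\lambda>0$ belongs to the resolvent set of $A$; write $R(\lambda,A)=(\lambda-A)^{-1}$. Moreover, there is exactly one semigroup $\{P(t)\}_{t\ge0}$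 (the minimal semigroup) that is smallest among all substochastic semigroups whose generator is an extension of $(A+B,\mathcal D(A))$; that is, $\{P(t)\}$ is such a semigroup and $P(t)u\le Q(t)u$ for all $t\ge0$, all $u\ge0$ in $L^1$ and every other such semigroup $\{Q(t)\}_{t\ge0}$. The limit $$Ku=\lim_{\lambda\downarrow0}BR(\lambda,A)u$$ exists in $L^1$ for every $u\in L^1$, and the operator $K\colon L^1\to L^1$ so defined has the following properties: (i) $K$ is a positive contraction, that is, $K$ is linear, $Ku\ge0$ for $u\ge0$, and $\|Ku\|\le\|u\|$ for all $u\in L^1$. (ii) $K$ is stochastic if and only if $\{S(t)\}_{t\ge0}$ is strongly stable. (iii) If $K$ is mean ergodic, then the minimal semigroup $\{P(t)\}_{t\ge0}$ is stochastic. -/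

import Mathlib

open MeasureTheory Filter Topology
open scoped NNReal

noncomputable section

namespace SubstochasticSemigroup

section Banach

variable {X : Type*} [NormedAddCommGroup X] [NormedSpace ℝ X]

/-- A strongly continuous one-parameter semigroup of bounded operators. -/
structure IsC0Semigroup (T : ℝ≥0 → X →L[ℝ] X) : Prop where
  map_zero : T 0 = ContinuousLinearMap.id ℝ X
  map_add : ∀ s t : ℝ≥0, T (s + t) = (T s).comp (T t)
  strongly_continuous : ∀ u : X, Tendsto (fun t : ℝ≥0 => T t u) (𝓝 0) (𝓝 u)

/-- `HasGenerator T u v`: the right derivative of `t ↦ T t u` at `0` exists and equals `v`. -/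
def HasGenerator (T : ℝ≥0 → X →L[ℝ] X) (u v : X) : Prop :=
  Tendsto (fun t : ℝ≥0 => (t : ℝ)⁻¹ • (T t u - u)) (𝓝[>] 0) (𝓝 v)

theorem HasGenerator.add {T : ℝ≥0 → X →L[ℝ] X} {u v u' v' : X}
    (h : HasGenerator T u v) (h' : HasGenerator T u' v') :
    HasGenerator T (u + u') (v + v') := by
  refine (Tendsto.add h h').congr fun t => ?_
  rw [(T t).map_add, ← smul_add]
  congr 1
  abel

theorem HasGenerator.smul {T : ℝ≥0 → X →L[ℝ] X} {u v : X} (c : ℝ)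
    (h : HasGenerator T u v) : HasGenerator T (c • u) (c • v) := by
  refine (Tendsto.const_smul h c).congr fun t => ?_
  rw [(T t).map_smul, smul_comm, ← smul_sub]

theorem HasGenerator.zero (T : ℝ≥0 → X →L[ℝ] X) : HasGenerator T (0 : X) 0 := by
  refine tendsto_const_nhds.congr fun t => ?_
  simp

theorem HasGenerator.unique {T : ℝ≥0 → X →L[ℝ] X} {u v v' : X}
    (h : HasGenerator T u v) (h' : HasGenerator T u v') : v = v' :=
  tendsto_nhds_unique h h'

/-- The infinitesimal generator of `T`, as a linear operator with domain
the set of all `u` for which the right derivative of `t ↦ T t u` at `0` exists. -/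
def generator (T : ℝ≥0 → X →L[ℝ] X) : X →ₗ.[ℝ] X where
  domain :=
    { carrier := {u | ∃ v, HasGenerator T u v}
      add_mem' := by
        rintro u u' ⟨v, h⟩ ⟨v', h'⟩
        exact ⟨v + v', h.add h'⟩
      zero_mem' := ⟨0, HasGenerator.zero T⟩
      smul_mem' := by
        rintro c u ⟨v, h⟩
        exact ⟨c • v, h.smul c⟩ }
  toFun :=
    { toFun := fun u => Classical.choose u.2
      map_add' := fun u u' =>
        (Classical.choose_spec (u + u').2).unique
          ((Classical.choose_spec u.2).add (Classical.choose_spec u'.2))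
      map_smul' := fun c u =>
        (Classical.choose_spec (c • u).2).unique ((Classical.choose_spec u.2).smul c) }

/-- The operator `lam - A`, defined on the domain of `A`. -/
def shifted (A : X →ₗ.[ℝ] X) (lam : ℝ) : A.domain →ₗ[ℝ] X :=
  lam • A.domain.subtype - A.toFun

/-- `lam` belongs to the resolvent set of `A`: the operator `lam - A` is a bijection of the
domain of `A` onto the whole space and its inverse is bounded. -/
def InResolventSet (A : X →ₗ.[ℝ] X) (lam : ℝ) : Prop :=
  Function.Bijective (shifted A lam) ∧ ∃ c : ℝ, ∀ u : A.domain, ‖(u : X)‖ ≤ c * ‖shifted A lam u‖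

open Classical in
/-- The resolvent `R(lam, A) = (lam - A)⁻¹`, with values in the domain of `A`
(and, by convention, the zero map when `lam` is not in the resolvent set of `A`). -/
def resolventMap (A : X →ₗ.[ℝ] X) (lam : ℝ) : X →ₗ[ℝ] A.domain :=
  if h : InResolventSet A lam then
    (LinearEquiv.ofBijective (shifted A lam) h.1).symm.toLinearMap
  else 0

/-- The operator `B R(lam, A)` on the whole space, for `B` defined at least on the
domain of `A`. -/
def perturbResolvent (A B : X →ₗ.[ℝ] X) (hAB : A.domain ≤ B.domain) (lam : ℝ) : X →ₗ[ℝ] X :=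
  B.toFun ∘ₗ Submodule.inclusion hAB ∘ₗ resolventMap A lam

/-- Mean ergodicity: the Cesàro means of the powers of `T` converge strongly. -/
def MeanErgodic (T : X →L[ℝ] X) : Prop :=
  ∀ u : X, ∃ v : X,
    Tendsto (fun N : ℕ => (N : ℝ)⁻¹ • ∑ n ∈ Finset.range N, (T ^ n) u) atTop (𝓝 v)

/-- Strong stability of a semigroup. -/
def StronglyStable (T : ℝ≥0 → X →L[ℝ] X) : Prop :=
  ∀ u : X, Tendsto (fun t : ℝ≥0 => T t u) atTop (𝓝 0)

end Banach

section LOne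

variable {E : Type*} [MeasurableSpace E] {m : Measure E}

/-- A positive contraction on `L¹(m)`. -/
def IsPositiveContraction (T : Lp ℝ 1 m →L[ℝ] Lp ℝ 1 m) : Prop :=
  (∀ u : Lp ℝ 1 m, 0 ≤ u → 0 ≤ T u) ∧ ∀ u : Lp ℝ 1 m, ‖T u‖ ≤ ‖u‖

/-- The set of densities `D(m)`. -/
def densities (m : Measure E) : Set (Lp ℝ 1 m) := {u | 0 ≤ u ∧ ‖u‖ = 1}

/-- A stochastic (Markov) operator: it maps densities to densities. -/
def IsStochastic (T : Lp ℝ 1 m →L[ℝ] Lp ℝ 1 m) : Prop :=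
  ∀ u ∈ densities m, T u ∈ densities m

/-- A strongly continuous semigroup of positive contractions on `L¹(m)`. -/
def IsSubstochasticSemigroup (T : ℝ≥0 → Lp ℝ 1 m →L[ℝ] Lp ℝ 1 m) : Prop :=
  IsC0Semigroup T ∧ ∀ t, IsPositiveContraction (T t)

/-- A strongly continuous semigroup of stochastic operators on `L¹(m)`. -/
def IsStochasticSemigroup (T : ℝ≥0 → Lp ℝ 1 m →L[ℝ] Lp ℝ 1 m) : Prop :=
  IsC0Semigroup T ∧ ∀ t, IsStochastic (T t)

/-- `P` is a substochastic semigroup whose generator extends `A + B` (the sum being defined on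
the intersection of the two domains). -/
def IsExtensionSemigroup (A B : Lp ℝ 1 m →ₗ.[ℝ] Lp ℝ 1 m)
    (P : ℝ≥0 → Lp ℝ 1 m →L[ℝ] Lp ℝ 1 m) : Prop :=
  IsSubstochasticSemigroup P ∧ A + B ≤ generator P

/-- `P` is the minimal semigroup of `A` and `B`: the smallest, in the pointwise order on the
positive cone, among all substochastic semigroups whose generator extends `A + B`. -/
def IsMinimalSemigroup (A B : Lp ℝ 1 m →ₗ.[ℝ] Lp ℝ 1 m)
    (P : ℝ≥0 → Lp ℝ 1 m →L[ℝ] Lp ℝ 1 m) : Prop :=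
  IsExtensionSemigroup A B P ∧
    ∀ Q : ℝ≥0 → Lp ℝ 1 m →L[ℝ] Lp ℝ 1 m, IsExtensionSemigroup A B Q →
      ∀ (t : ℝ≥0) (u : Lp ℝ 1 m), 0 ≤ u → P t u ≤ Q t u

end LOne

end SubstochasticSemigroup

end

open SubstochasticSemigroup

/-! On the positive cone of L¹ the norm is the integral `φ`, hence additive, so monotone bounded
nets converge in norm. Put R_l = R(l, A), the Laplace transform of `S`, and F_l = B R_l. Since (l -
A) R_l = 1 and A + B has zero integral on positive elements, `IsKatoPair.map_F` gives the balance
φ(F_l u) = φ(u) - l φ(R_l u) for u ≥ 0. So F_l is a positive contraction, and by the resolvent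
identity it increases as l decreases; its monotone limit at 0 is K.

By the balance, φ(u) - φ(Ku) is the limit of l φ(R_l u). This is an exponential average of the
decreasing function ‖S(t)u‖, so it vanishes for all u ≥ 0 exactly when `S` is strongly stable
(`IsContractionSemigroup.stronglyStable_iff`).

The minimal semigroup comes from Kato's series G_l = ∑ R_l F_l^n, a left inverse of l - A - B on the
domain of A. The G_l satisfy the resolvent identity and the Hille-Yosida bound, and G_1 has dense
range, so `IsResolventFamily.exists_semigroup` applies. The resolvent of any competitor dominates
the partial sums, hence G_l, and the Yosida approximations carry this order to the semigroups
(`IsKatoResolvent.le_semigroup`).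

Finally l φ(G_l u) = φ(u) - lim φ(F_l^N u) for u ≥ 0, so `P` preserves the integral once the powers
of F_l lose all mass (`IsKatoResolvent.map_semigroup_eq`). If K is mean ergodic, F_l ≤ K transfers
the question to a positive fixed vector f of K; there F_l^n f decreases to a fixed vector of F_l,
which is 0 by the balance (`IsKatoPair.tendsto_map_pow`). -/

noncomputable section

namespace SubstochasticSemigroup

/-! ### Contraction semigroups and their resolvents as Laplace transforms. -/

section ContractionSemigroup

variable {X : Type*} [NormedAddCommGroup X] [NormedSpace ℝ X]

/-- A strongly continuous semigroup of contractions. -/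
structure IsContractionSemigroup (T : ℝ≥0 → X →L[ℝ] X) : Prop extends IsC0Semigroup T where
  norm_le : ∀ t u, ‖T t u‖ ≤ ‖u‖

theorem tendsto_coe_nhdsGT_zero :
    Tendsto (fun t : ℝ≥0 => (t : ℝ)) (𝓝[>] 0) (𝓝[>] 0) := by
  refine tendsto_nhdsWithin_iff.2 ⟨?_, ?_⟩
  · exact (NNReal.continuous_coe.tendsto' 0 0 (by simp)).mono_left nhdsWithin_le_nhds
  · filter_upwards [self_mem_nhdsWithin] with t ht
    exact NNReal.coe_pos.2 ht

theorem hasGenerator_of_hasDerivAt {T : ℝ≥0 → X →L[ℝ] X} {u v : X} {k : ℝ → X}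
    (hk : HasDerivAt k v 0) (hT : ∀ t : ℝ≥0, T t u = k t) (hu : k 0 = u) :
    HasGenerator T u v := by
  have h := (hasDerivAt_iff_tendsto_slope_zero.1 hk).mono_left
    (nhdsWithin_mono (0 : ℝ) (fun x (hx : 0 < x) => hx.ne') : 𝓝[>] (0 : ℝ) ≤ 𝓝[≠] 0)
  refine (h.comp tendsto_coe_nhdsGT_zero).congr fun t => ?_
  simp [hT, hu]

/-- If two commuting contraction semigroups have the generators `a` and `b` at `w`, then they
differ by at most `t * ‖a - b‖` at time `t`. -/
theorem norm_sub_le_of_commute {U V : ℝ≥0 → X →L[ℝ] X} (hU : IsContractionSemigroup U)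
    (hV : IsContractionSemigroup V) (hc : ∀ s, Commute (U s) (V s)) {w a b : X}
    (ha : HasGenerator U w a) (hb : HasGenerator V w b) (t : ℝ≥0) :
    ‖U t w - V t w‖ ≤ t * ‖a - b‖ := by
  rcases eq_or_ne t 0 with rfl | ht
  · simp [hU.map_zero, hV.map_zero]
  have powU : ∀ {W : ℝ≥0 → X →L[ℝ] X}, IsContractionSemigroup W →
      ∀ (h : ℝ≥0) (n : ℕ), W (n * h) = W h ^ n := by
    intro W hW h n
    induction n with
    | zero => simp [hW.map_zero]; rfl
    | succ n ih =>
      rw [pow_succ, ← ih]; push_cast; rw [add_mul, one_mul, hW.map_add]; rfl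
  have powle : ∀ {W : ℝ≥0 → X →L[ℝ] X}, IsContractionSemigroup W →
      ∀ (h : ℝ≥0) (n : ℕ) (u : X), ‖(W h ^ n) u‖ ≤ ‖u‖ := by
    intro W hW h n u
    rw [← powU hW]; exact hW.norm_le _ _
  have key : ∀ n : ℕ, 0 < n → ‖U t w - V t w‖ ≤
      t * ‖(((t / n : ℝ≥0)) : ℝ)⁻¹ • (U (t / n) w - w) -
        (((t / n : ℝ≥0)) : ℝ)⁻¹ • (V (t / n) w - w)‖ := by
    intro n hn
    have hn' : (n : ℝ≥0) ≠ 0 := by exact_mod_cast hn.ne'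
    set h := t / n with hh
    have hth : t = n * h := by rw [hh]; field_simp
    -- With h = t/n, U_h^n - V_h^n factors through U_h - V_h by commutativity; each of the n terms
    -- has norm at most ‖U_h w - V_h w‖, and n = t/h turns this into difference quotients.
    have hgeom := (hc h).geom_sum₂_mul n
    have h1 : U t w - V t w =
        ∑ i ∈ Finset.range n, (U h ^ i) ((V h ^ (n - 1 - i)) (U h w - V h w)) := by
      have := congrArg (fun W : X →L[ℝ] X => W w) hgeom
      rw [hth, powU hU, powU hV]
      simpa using this.symm
    have hpos : 0 < (h : ℝ) := NNReal.coe_pos.2 (by rw [hh]; positivity)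
    rw [← smul_sub, norm_smul, sub_sub_sub_cancel_right, norm_inv, Real.norm_of_nonneg hpos.le,
      ← mul_assoc, hth]
    have : ((n * h : ℝ≥0) : ℝ) * (h : ℝ)⁻¹ = n := by push_cast; field_simp
    rw [this, ← hth, h1]
    refine (norm_sum_le _ _).trans ?_
    refine (Finset.sum_le_card_nsmul _ _ ‖U h w - V h w‖ fun i _ => ?_).trans ?_
    · exact (powle hU _ _ _).trans (powle hV _ _ _)
    · simp
  have hlim : Tendsto (fun n : ℕ => (t / n : ℝ≥0)) atTop (𝓝[>] 0) := by
    refine tendsto_nhdsWithin_iff.2 ⟨?_, ?_⟩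
    · rw [← NNReal.tendsto_coe]
      simpa using tendsto_const_div_atTop_nhds_zero_nat (t : ℝ)
    · filter_upwards [eventually_gt_atTop 0] with n hn
      have : 0 < (n : ℝ≥0) := by exact_mod_cast hn
      exact div_pos (pos_iff_ne_zero.2 ht) this
  have h2 : Tendsto (fun n : ℕ => (t : ℝ) * ‖(((t / n : ℝ≥0)) : ℝ)⁻¹ • (U (t / n) w - w) -
        (((t / n : ℝ≥0)) : ℝ)⁻¹ • (V (t / n) w - w)‖) atTop (𝓝 (t * ‖a - b‖)) :=
    (((ha.comp hlim).sub (hb.comp hlim)).norm).const_mul _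
  exact ge_of_tendsto h2 ((eventually_gt_atTop 0).mono key)

namespace IsContractionSemigroup

variable {T : ℝ≥0 → X →L[ℝ] X}

theorem continuous (hT : IsContractionSemigroup T) (u : X) : Continuous fun t => T t u := by
  have h0 : Tendsto (fun r : ℝ≥0 => ‖T r u - u‖) (𝓝 0) (𝓝 0) := by
    have := ((hT.strongly_continuous u).sub_const u).norm
    simpa using this
  have hle : ∀ s t : ℝ≥0, s ≤ t → ‖T t u - T s u‖ ≤ ‖T (t - s) u - u‖ := by
    intro s t hst
    have : T t u = T s (T (t - s) u) := by
      conv_lhs => rw [← add_tsub_cancel_of_le hst, hT.map_add]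
      rfl
    rw [this, ← map_sub]
    exact hT.norm_le _ _
  refine continuous_iff_continuousAt.2 fun s => ?_
  rw [ContinuousAt, tendsto_iff_norm_sub_tendsto_zero]
  -- Subtraction in `ℝ≥0` is truncated, so this sum is |t - s|.
  have h1 : Tendsto (fun t : ℝ≥0 => (t - s) + (s - t)) (𝓝 s) (𝓝 0) := by
    have : Continuous fun t : ℝ≥0 => (t - s) + (s - t) := by fun_prop
    exact this.tendsto' s 0 (by simp)
  refine squeeze_zero (fun t => norm_nonneg _) (fun t => ?_) (h0.comp h1)
  rcases le_total s t with h | h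
  · simpa [tsub_eq_zero_of_le h] using hle s t h
  · rw [norm_sub_rev]
    simpa [tsub_eq_zero_of_le h] using hle t s h

end IsContractionSemigroup

theorem hasGenerator_generator {T : ℝ≥0 → X →L[ℝ] X} (u : (generator T).domain) : HasGenerator T u (generator T u) :=
  Classical.choose_spec u.2

theorem mem_domain_generator {u v : X} (h : HasGenerator T u v) : u ∈ (generator T).domain :=
  ⟨v, h⟩

theorem shifted_resolventMap {A : X →ₗ.[ℝ] X} {lam : ℝ} (h : InResolventSet A lam) (u : X) :
    lam • (resolventMap A lam u : X) - A (resolventMap A lam u) = u := by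
  have : shifted A lam (resolventMap A lam u) = u := by
    rw [resolventMap, dif_pos h]
    exact (LinearEquiv.ofBijective (shifted A lam) h.1).apply_symm_apply u
  exact this

theorem resolventMap_shifted {A : X →ₗ.[ℝ] X} {lam : ℝ} (h : InResolventSet A lam) (w : A.domain) :
    resolventMap A lam (lam • (w : X) - A w) = w := by
  rw [resolventMap, dif_pos h]
  exact (LinearEquiv.ofBijective (shifted A lam) h.1).symm_apply_apply w

theorem integral_exp_neg_mul {lam : ℝ} (hl : 0 < lam) :
    ∫ t in Set.Ioi (0 : ℝ), Real.exp (-lam * t) = lam⁻¹ := by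
  rw [integral_exp_mul_Ioi (by linarith) 0]
  simp

/-- The Laplace transform of the orbit of `u`. -/
def laplace (T : ℝ≥0 → X →L[ℝ] X) (lam : ℝ) (u : X) : X :=
  ∫ t in Set.Ioi (0 : ℝ), Real.exp (-lam * t) • T t.toNNReal u

namespace IsContractionSemigroup

variable {T : ℝ≥0 → X →L[ℝ] X} {lam : ℝ}

theorem continuous_integrand (hT : IsContractionSemigroup T) (lam : ℝ) (u : X) :
    Continuous fun t : ℝ => Real.exp (-lam * t) • T t.toNNReal u := by
  have := (hT.continuous u).comp continuous_real_toNNReal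
  exact (by fun_prop : Continuous fun t : ℝ => Real.exp (-lam * t)).smul this

theorem norm_integrand_le (hT : IsContractionSemigroup T) (lam : ℝ) (u : X) (t : ℝ) :
    ‖Real.exp (-lam * t) • T t.toNNReal u‖ ≤ Real.exp (-lam * t) * ‖u‖ := by
  rw [norm_smul, Real.norm_of_nonneg (Real.exp_pos _).le]
  exact mul_le_mul_of_nonneg_left (hT.norm_le _ _) (Real.exp_pos _).le

theorem integrableOn (hT : IsContractionSemigroup T) (hl : 0 < lam) (u : X) :
    IntegrableOn (fun t : ℝ => Real.exp (-lam * t) • T t.toNNReal u) (Set.Ioi 0) := by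
  refine Integrable.mono' ((exp_neg_integrableOn_Ioi 0 hl).mul_const ‖u‖)
    (hT.continuous_integrand lam u).aestronglyMeasurable.restrict ?_
  exact ae_of_all _ fun t => hT.norm_integrand_le lam u t

theorem norm_laplace_le (hT : IsContractionSemigroup T) (hl : 0 < lam) (u : X) :
    ‖laplace T lam u‖ ≤ lam⁻¹ * ‖u‖ := by
  rw [← integral_exp_neg_mul hl, ← integral_mul_const]
  exact norm_integral_le_of_norm_le ((exp_neg_integrableOn_Ioi 0 hl).mul_const ‖u‖)
    (ae_of_all _ fun t => hT.norm_integrand_le lam u t)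

/-- The Laplace transform as a bounded operator. -/
theorem exists_laplace (hT : IsContractionSemigroup T) (hl : 0 < lam) :
    ∃ R : X →L[ℝ] X, ∀ u, R u = laplace T lam u := by
  refine ⟨LinearMap.mkContinuous ⟨⟨laplace T lam, fun u v => ?_⟩, fun c u => ?_⟩ lam⁻¹
    (hT.norm_laplace_le hl), fun u => rfl⟩
  · simp only [laplace, map_add, smul_add]
    exact integral_add (hT.integrableOn hl u) (hT.integrableOn hl v)
  · simp only [laplace, map_smul, RingHom.id_apply]
    rw [← integral_smul]
    simp only [smul_comm c]

theorem apply_laplace_eq_laplace_apply [CompleteSpace X] (hT : IsContractionSemigroup T)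
    (hl : 0 < lam) (h : ℝ≥0) (u : X) : T h (laplace T lam u) = laplace T lam (T h u) := by
  rw [laplace, ← ContinuousLinearMap.integral_comp_comm _ (hT.integrableOn hl u), laplace]
  congr 1
  ext t
  rw [map_smul]
  congr 1
  calc T h (T t.toNNReal u) = T (h + t.toNNReal) u := by rw [hT.map_add]; rfl
    _ = T (t.toNNReal) (T h u) := by rw [add_comm, hT.map_add]; rfl

/-- Shifting the integration variable by h leaves the integral over (h, ∞). The right side is
explicitly differentiable in h, which yields the generator by the product rule. -/
theorem apply_laplace [CompleteSpace X] (hT : IsContractionSemigroup T) (hl : 0 < lam)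
    (h : ℝ≥0) (u : X) :
    T h (laplace T lam u) = Real.exp (lam * h) •
      (laplace T lam u - ∫ t in (0 : ℝ)..h, Real.exp (-lam * t) • T t.toNNReal u) := by
  have hint := hT.integrableOn hl u
  rw [laplace, ← intervalIntegral.integral_Ioi_sub_Ioi (b := (h : ℝ)) hint h.coe_nonneg,
    sub_sub_cancel, ← ContinuousLinearMap.integral_comp_comm _ hint, ← integral_smul]
  have hpre : (fun t : ℝ => t + h) ⁻¹' Set.Ioi (h : ℝ) = Set.Ioi 0 := by
    ext t; simp
  have := (measurePreserving_add_right volume (h : ℝ)).setIntegral_preimage_emb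
    (measurableEmbedding_addRight (h : ℝ))
    (fun t => Real.exp (lam * h) • Real.exp (-lam * t) • T t.toNNReal u) (Set.Ioi (h : ℝ))
  rw [hpre] at this
  refine Eq.trans ?_ this
  refine setIntegral_congr_fun measurableSet_Ioi fun t ht => ?_
  have ht' : (0 : ℝ) ≤ t := le_of_lt ht
  simp only [map_smul, smul_smul, ← Real.exp_add]
  rw [Real.toNNReal_add ht' h.coe_nonneg, Real.toNNReal_coe, add_comm t.toNNReal, hT.map_add]
  simp only [ContinuousLinearMap.comp_apply]
  congr 2
  ring

theorem hasGenerator_laplace [CompleteSpace X] (hT : IsContractionSemigroup T) (hl : 0 < lam)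
    (u : X) : HasGenerator T (laplace T lam u) (lam • laplace T lam u - u) := by
  have hcont := hT.continuous_integrand lam u
  have h1 : HasDerivAt (fun h : ℝ => ∫ t in (0 : ℝ)..h, Real.exp (-lam * t) • T t.toNNReal u) u 0 := by
    have := intervalIntegral.integral_hasDerivAt_right (a := 0) (b := 0)
      (hcont.intervalIntegrable 0 0) (hcont.stronglyMeasurableAtFilter _ _) hcont.continuousAt
    simpa [hT.map_zero] using this
  have h2 : HasDerivAt (fun h : ℝ => Real.exp (lam * h)) lam 0 := by
    have := ((hasDerivAt_id (0 : ℝ)).const_mul lam).exp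
    simpa using this
  have h3 := h2.smul (h1.const_sub (laplace T lam u))
  refine hasGenerator_of_hasDerivAt (h3.congr_deriv ?_) (fun t => hT.apply_laplace hl t u) ?_
  · simp; abel
  · simp

/-- The bounded Laplace operator commutes with the semigroup, so it maps the difference quotients of
w to those of its image; uniqueness of the limit compares this with `hasGenerator_laplace`. -/
theorem laplace_eq_of_hasGenerator [CompleteSpace X] (hT : IsContractionSemigroup T)
    (hl : 0 < lam) {w v : X} (h : HasGenerator T w v) : laplace T lam (lam • w - v) = w := by
  obtain ⟨R, hR⟩ := hT.exists_laplace hl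
  have h1 := hT.hasGenerator_laplace hl w
  have h2 : HasGenerator T (laplace T lam w) (R v) := by
    refine ((R.continuous.tendsto v).comp h).congr fun t => ?_
    rw [Function.comp_apply, map_smul, map_sub, hR, hR, hT.apply_laplace_eq_laplace_apply hl]
  have h3 := h1.unique h2
  rw [← hR, map_sub, map_smul, ← h3, hR]
  abel

theorem inResolventSet [CompleteSpace X] (hT : IsContractionSemigroup T) (hl : 0 < lam) :
    InResolventSet (generator T) lam := by
  have hinv : ∀ u : (generator T).domain, laplace T lam (shifted (generator T) lam u) = u :=
    fun u => hT.laplace_eq_of_hasGenerator hl (hasGenerator_generator u)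
  refine ⟨⟨fun u v huv => ?_, fun v => ?_⟩, lam⁻¹, fun u => ?_⟩
  · exact Subtype.ext (by rw [← hinv u, huv, hinv])
  · have hg := hT.hasGenerator_laplace hl v
    have := (hasGenerator_generator ⟨laplace T lam v, mem_domain_generator hg⟩).unique hg
    refine ⟨⟨laplace T lam v, mem_domain_generator hg⟩, ?_⟩
    exact (congrArg (lam • laplace T lam v - ·) this).trans (sub_sub_cancel _ _)
  · conv_lhs => rw [← hinv u]
    exact hT.norm_laplace_le hl _

theorem resolventMap_eq_laplace [CompleteSpace X] (hT : IsContractionSemigroup T) (hl : 0 < lam)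
    (u : X) : (resolventMap (generator T) lam u : X) = laplace T lam u := by
  conv_rhs => rw [← shifted_resolventMap (hT.inResolventSet hl) u]
  exact (hT.laplace_eq_of_hasGenerator hl (hasGenerator_generator _)).symm

theorem laplace_sub_laplace [CompleteSpace X] (hT : IsContractionSemigroup T) {mu : ℝ}
    (hl : 0 < lam) (hm : 0 < mu) (v : X) :
    laplace T lam v - laplace T mu v = (mu - lam) • laplace T lam (laplace T mu v) := by
  obtain ⟨R, hR⟩ := hT.exists_laplace hl
  have := hT.laplace_eq_of_hasGenerator hl (hT.hasGenerator_laplace hm v)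
  simp only [← hR, map_sub, map_smul] at this ⊢
  rw [sub_smul]
  nth_rewrite 1 [← this]
  abel

/-- By `hasGenerator_laplace`, u is `lam • laplace T lam u` minus a limit of difference quotients,
and these lie in the range because the Laplace operator commutes with `T`. -/
theorem mem_closure_range_laplace [CompleteSpace X] (hT : IsContractionSemigroup T)
    (hl : 0 < lam) (u : X) : u ∈ closure (Set.range (laplace T lam)) := by
  obtain ⟨R, hR⟩ := hT.exists_laplace hl
  have h := (tendsto_const_nhds (x := lam • laplace T lam u)).sub (hT.hasGenerator_laplace hl u)
  rw [sub_sub_cancel] at h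
  have : (𝓝[>] (0 : ℝ≥0)).NeBot := inferInstance
  refine mem_closure_of_tendsto h (Eventually.of_forall fun t => ?_)
  refine ⟨lam • u - (t : ℝ)⁻¹ • (T t u - u), ?_⟩
  rw [← hR, map_sub, map_smul, map_smul, map_sub, hR, hR, hT.apply_laplace_eq_laplace_apply hl]

end IsContractionSemigroup

end ContractionSemigroup

/-! ### Strong limits of contractions, tested on dense sets. -/

section StrongLimits

variable {X Y ι : Type*} [NormedAddCommGroup X] [NormedSpace ℝ X] {l : Filter ι}

theorem exists_clm_of_tendsto [l.NeBot] {F : ι → X →L[ℝ] X} {f : X → X}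
    (hf : ∀ u, Tendsto (fun i => F i u) l (𝓝 (f u))) (hF : ∀ᶠ i in l, ∀ u, ‖F i u‖ ≤ ‖u‖) :
    ∃ P : X →L[ℝ] X, (∀ u, P u = f u) ∧ ∀ u, ‖P u‖ ≤ ‖u‖ := by
  have hn : ∀ u, ‖f u‖ ≤ 1 * ‖u‖ := fun u => by
    rw [one_mul]
    exact le_of_tendsto (hf u).norm (hF.mono fun i hi => hi u)
  refine ⟨LinearMap.mkContinuous ⟨⟨f, fun u v => ?_⟩, fun c u => ?_⟩ 1 hn, fun u => rfl,
    fun u => by simpa using hn u⟩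
  · refine tendsto_nhds_unique (hf (u + v)) (((hf u).add (hf v)).congr fun i => ?_)
    rw [map_add]
  · refine tendsto_nhds_unique (hf (c • u)) (((hf u).const_smul c).congr fun i => ?_)
    rw [map_smul]

theorem tendsto_of_denseRange {F : ι → X →L[ℝ] X} (hF : ∀ᶠ i in l, ∀ u, ‖F i u‖ ≤ ‖u‖)
    {g : Y → X} (hg : DenseRange g) {G : X →L[ℝ] X} (hG : ∀ u, ‖G u‖ ≤ ‖u‖)
    (h : ∀ v, Tendsto (fun i => F i (g v)) l (𝓝 (G (g v)))) (u : X) :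
    Tendsto (fun i => F i u) l (𝓝 (G u)) := by
  refine Metric.tendsto_nhds.2 fun ε hε => ?_
  obtain ⟨v, hv⟩ := hg.exists_dist_lt u (by positivity : 0 < ε / 3)
  filter_upwards [hF, Metric.tendsto_nhds.1 (h v) (ε / 3) (by positivity)] with i hi hiv
  have h1 : dist (F i u) (F i (g v)) ≤ dist u (g v) := by
    rw [dist_eq_norm, dist_eq_norm, ← map_sub]; exact hi _
  have h2 : dist (G u) (G (g v)) ≤ dist u (g v) := by
    rw [dist_eq_norm, dist_eq_norm, ← map_sub]; exact hG _
  have h3 := dist_triangle4 (F i u) (F i (g v)) (G (g v)) (G u)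
  rw [dist_comm (G (g v))] at h3
  linarith

theorem cauchySeq_of_denseRange {F : ℝ → X →L[ℝ] X}
    (hF : ∀ᶠ i in atTop, ∀ u, ‖F i u‖ ≤ ‖u‖) {g : Y → X} (hg : DenseRange g)
    (h : ∀ v, CauchySeq fun i => F i (g v)) (u : X) : CauchySeq fun i => F i u := by
  refine Metric.cauchySeq_iff.2 fun ε hε => ?_
  obtain ⟨v, hv⟩ := hg.exists_dist_lt u (by positivity : 0 < ε / 3)
  obtain ⟨N, hN⟩ := Metric.cauchySeq_iff.1 (h v) (ε / 3) (by positivity)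
  obtain ⟨M, hM⟩ := eventually_atTop.1 hF
  refine ⟨max M N, fun i hi j hj => ?_⟩
  have h1 : ∀ i, max M N ≤ i → dist (F i u) (F i (g v)) ≤ dist u (g v) := fun i hi => by
    rw [dist_eq_norm, dist_eq_norm, ← map_sub]; exact hM i (le_trans (le_max_left _ _) hi) _
  have h3 := dist_triangle4 (F i u) (F i (g v)) (F j (g v)) (F j u)
  rw [dist_comm (F j (g v))] at h3
  have := hN i (le_trans (le_max_right _ _) hi) j (le_trans (le_max_right _ _) hj)
  linarith [h1 i hi, h1 j hj]

end StrongLimits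

/-! ### Yosida approximation and the Hille-Yosida theorem. -/

section Yosida

variable {X : Type*} [NormedAddCommGroup X] [NormedSpace ℝ X]

/-- The resolvents `J lam`, `lam > 0`, of a densely defined generator of contractions. -/
structure IsResolventFamily (J : ℝ → X →L[ℝ] X) : Prop where
  sub_eq : ∀ {l m : ℝ}, 0 < l → 0 < m → ∀ v, J l v - J m v = (m - l) • J l (J m v)
  norm_le : ∀ {l : ℝ}, 0 < l → ∀ v, l * ‖J l v‖ ≤ ‖v‖
  dense : DenseRange (J 1)

/-- The Yosida approximation of the operator with resolvents `J`. -/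
def yosidaGen (J : ℝ → X →L[ℝ] X) (l : ℝ) : X →L[ℝ] X := (l ^ 2) • J l - l • 1

/-- The semigroup generated by the Yosida approximation. -/
def yosida (J : ℝ → X →L[ℝ] X) (l : ℝ) (t : ℝ≥0) : X →L[ℝ] X :=
  NormedSpace.exp ((t : ℝ) • yosidaGen J l)

theorem hasSum_exp_apply [CompleteSpace X] (W : X →L[ℝ] X) (u : X) :
    HasSum (fun n : ℕ => ((n.factorial : ℝ)⁻¹) • (W ^ n) u) (NormedSpace.exp W u) := by
  have h := NormedSpace.exp_series_hasSum_exp' (𝕂 := ℝ) W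
  simpa using h.mapL (ContinuousLinearMap.apply ℝ X u)

theorem hasSum_real_exp (c : ℝ) :
    HasSum (fun n : ℕ => ((n.factorial : ℝ)⁻¹) * c ^ n) (Real.exp c) := by
  have h := NormedSpace.exp_series_hasSum_exp' (𝕂 := ℝ) c
  rw [← Real.exp_eq_exp_ℝ] at h
  simpa using h

theorem norm_exp_apply_le [CompleteSpace X] {W : X →L[ℝ] X} {c : ℝ} (hc : 0 ≤ c)
    (hW : ∀ u, ‖W u‖ ≤ c * ‖u‖) (u : X) : ‖NormedSpace.exp W u‖ ≤ Real.exp c * ‖u‖ := by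
  have hpow : ∀ n : ℕ, ‖(W ^ n) u‖ ≤ c ^ n * ‖u‖ := by
    intro n
    induction n with
    | zero => simp
    | succ n ih =>
      rw [pow_succ', pow_succ', mul_assoc]
      exact (hW _).trans (mul_le_mul_of_nonneg_left ih hc)
  have h := hasSum_exp_apply W u
  rw [← h.tsum_eq]
  refine tsum_of_norm_bounded ((hasSum_real_exp c).mul_right ‖u‖) fun n => ?_
  rw [norm_smul, Real.norm_of_nonneg (by positivity), mul_assoc]
  exact mul_le_mul_of_nonneg_left (hpow n) (by positivity)

theorem exp_add_of_commute [CompleteSpace X] {V W : X →L[ℝ] X} (h : Commute V W) :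
    NormedSpace.exp (V + W) = NormedSpace.exp V * NormedSpace.exp W := by
  let _ : NormedAlgebra ℚ (X →L[ℝ] X) := NormedAlgebra.restrictScalars ℚ ℝ _
  exact NormedSpace.exp_add_of_commute h

/-- Splitting off the scalar part leaves a power series in `J l` with nonnegative coefficients.
Contractivity, positivity and order comparison are all read off from this form. -/
theorem yosida_apply [CompleteSpace X] (J : ℝ → X →L[ℝ] X) (l : ℝ) (t : ℝ≥0) (u : X) :
    yosida J l t u = Real.exp (-(l * t)) • NormedSpace.exp ((t * l ^ 2) • J l) u := by
  have h1 : (t : ℝ) • yosidaGen J l = (-(l * t)) • (1 : X →L[ℝ] X) + (t * l ^ 2) • J l := by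
    rw [yosidaGen, smul_sub, smul_smul, smul_smul, neg_smul, mul_comm l]
    abel
  have h2 : NormedSpace.exp ((-(l * t)) • (1 : X →L[ℝ] X)) =
      Real.exp (-(l * t)) • (1 : X →L[ℝ] X) := by
    ext v
    refine (hasSum_exp_apply _ v).unique ?_
    convert (hasSum_real_exp (-(l * t))).smul_const v using 2 with n
    · rw [smul_pow, one_pow, mul_smul]
      rfl
    · rfl
  rw [yosida, h1, exp_add_of_commute ((Commute.one_left _).smul_left _), h2]
  simp

theorem hasGenerator_yosida [CompleteSpace X] (J : ℝ → X →L[ℝ] X) (l : ℝ) (w : X) :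
    HasGenerator (yosida J l) w (yosidaGen J l w) := by
  have h := hasDerivAt_exp_smul_const (𝕂 := ℝ) (yosidaGen J l) 0
  have h2 := ((ContinuousLinearMap.apply ℝ X w).hasFDerivAt.comp_hasDerivAt (0 : ℝ) h)
  refine hasGenerator_of_hasDerivAt (h2.congr_deriv ?_) (fun t => rfl) ?_ <;> simp

namespace IsResolventFamily

variable {J : ℝ → X →L[ℝ] X} {l m : ℝ}

theorem commute (hJ : IsResolventFamily J) (hl : 0 < l) (hm : 0 < m) : Commute (J l) (J m) := by
  rcases eq_or_ne l m with rfl | hne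
  · exact Commute.refl _
  ext v
  have h1 := hJ.sub_eq hl hm v
  have h2 := hJ.sub_eq hm hl v
  have h3 : (m - l) • J l (J m v) = (m - l) • J m (J l v) := by
    rw [← h1, ← neg_sub l m, neg_smul, ← h2]; abel
  exact smul_right_injective X (sub_ne_zero.2 hne.symm) h3

theorem commute_yosidaGen (hJ : IsResolventFamily J) (hl : 0 < l) (hm : 0 < m) :
    Commute (yosidaGen J l) (yosidaGen J m) := by
  have := hJ.commute hl hm
  unfold yosidaGen
  exact (((this.smul_left _).smul_right _).sub_left
    ((Commute.one_left _).smul_left _ )).sub_right ((Commute.one_right _).smul_right _)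

/-- On the dense range of `J 1` the resolvent identity makes the error J_l(J_1 v - v), of size at
most ‖J_1 v - v‖ / l. -/
theorem tendsto_smul (hJ : IsResolventFamily J) (u : X) :
    Tendsto (fun l => l • J l u) atTop (𝓝 u) := by
  have hF : ∀ᶠ l : ℝ in atTop, ∀ u, ‖(l • J l) u‖ ≤ ‖u‖ := by
    filter_upwards [eventually_gt_atTop 0] with l hl u
    rw [smul_apply, norm_smul, Real.norm_of_nonneg hl.le]
    exact hJ.norm_le hl u
  refine tendsto_of_denseRange (F := fun l => l • J l) (G := ContinuousLinearMap.id ℝ X) hF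
    hJ.dense (fun u => le_rfl) (fun v => ?_) u
  rw [tendsto_iff_norm_sub_tendsto_zero]
  have hlim : Tendsto (fun l : ℝ => l⁻¹ * ‖J 1 v - v‖) atTop (𝓝 0) := by
    simpa using tendsto_inv_atTop_zero.mul_const ‖J 1 v - v‖
  refine squeeze_zero' (Eventually.of_forall fun _ => norm_nonneg _) ?_ hlim
  filter_upwards [eventually_gt_atTop 0] with l hl
  have h : l • J l (J 1 v) - J 1 v = J l (J 1 v - v) := by
    have := hJ.sub_eq hl one_pos v
    rw [sub_smul, one_smul] at this
    rw [map_sub]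
    rw [← sub_eq_zero] at this ⊢
    rw [← this]
    abel
  change ‖l • J l (J 1 v) - J 1 v‖ ≤ _
  rw [h, inv_mul_eq_div, le_div_iff₀ hl, mul_comm]
  exact hJ.norm_le hl _

/-- On the range of `J 1` the approximation equals l J_l (J_1 v - v), so `tendsto_smul` applies. -/
theorem tendsto_yosidaGen (hJ : IsResolventFamily J) (v : X) :
    Tendsto (fun l => yosidaGen J l (J 1 v)) atTop (𝓝 (J 1 v - v)) := by
  refine (hJ.tendsto_smul (J 1 v - v)).congr' ?_
  filter_upwards [eventually_gt_atTop 0] with l hl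
  have := hJ.sub_eq hl one_pos v
  rw [sub_smul, one_smul] at this
  have h2 : l • J l (J 1 v) = J l (J 1 v) - J l v + J 1 v := by
    rw [← sub_eq_zero] at this ⊢
    rw [← this]
    abel
  change _ = (l ^ 2) • J l (J 1 v) - l • J 1 v
  rw [pow_two, mul_smul, h2, ← smul_sub, map_sub, add_sub_cancel_right]

theorem commute_yosida (hJ : IsResolventFamily J) (hl : 0 < l) (hm : 0 < m) (t : ℝ≥0) :
    Commute (yosida J l t) (yosida J m t) :=
  ((((hJ.commute_yosidaGen hl hm).smul_left _).smul_right _).exp_left).exp_right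

variable [CompleteSpace X]

theorem yosida_isContractionSemigroup (hJ : IsResolventFamily J) (hl : 0 < l) :
    IsContractionSemigroup (yosida J l) := by
  refine ⟨⟨?_, fun s t => ?_, fun u => ?_⟩, fun t u => ?_⟩
  · simp [yosida]; rfl
  · rw [yosida, NNReal.coe_add, add_smul,
      exp_add_of_commute (((Commute.refl _).smul_left _).smul_right _)]
    rfl
  · have h := (hasDerivAt_exp_smul_const (𝕂 := ℝ) (yosidaGen J l) 0).continuousAt.tendsto
    have h2 := ((ContinuousLinearMap.apply ℝ X u).continuous.tendsto _).comp
      (h.comp (NNReal.continuous_coe.tendsto' 0 0 rfl))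
    simpa [Function.comp_def, yosida] using h2
  · rw [yosida_apply, norm_smul, Real.norm_of_nonneg (Real.exp_pos _).le]
    have hW : ∀ u, ‖((t * l ^ 2) • J l) u‖ ≤ (l * t) * ‖u‖ := fun u => by
      rw [smul_apply, norm_smul, Real.norm_of_nonneg (by positivity)]
      calc (t : ℝ) * l ^ 2 * ‖J l u‖ = (l * t) * (l * ‖J l u‖) := by ring
        _ ≤ _ := mul_le_mul_of_nonneg_left (hJ.norm_le hl u) (by positivity)
    calc _ ≤ Real.exp (-(l * t)) * (Real.exp (l * t) * ‖u‖) :=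
          mul_le_mul_of_nonneg_left (norm_exp_apply_le (by positivity) hW u) (Real.exp_pos _).le
      _ = ‖u‖ := by rw [← mul_assoc, ← Real.exp_add]; simp

theorem norm_yosida_sub_le (hJ : IsResolventFamily J) (hl : 0 < l) (hm : 0 < m) (t : ℝ≥0)
    (w : X) :
    ‖yosida J l t w - yosida J m t w‖ ≤ t * ‖yosidaGen J l w - yosidaGen J m w‖ :=
  norm_sub_le_of_commute (hJ.yosida_isContractionSemigroup hl)
    (hJ.yosida_isContractionSemigroup hm) (fun s => hJ.commute_yosida hl hm s)
    (hasGenerator_yosida J l w) (hasGenerator_yosida J m w) t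

/-- The generation theorem of Hille and Yosida. -/
theorem exists_semigroup (hJ : IsResolventFamily J) :
    ∃ P : ℝ≥0 → X →L[ℝ] X, IsContractionSemigroup P ∧
      (∀ t u, Tendsto (fun l => yosida J l t u) atTop (𝓝 (P t u))) ∧
      ∀ v, HasGenerator P (J 1 v) (J 1 v - v) := by
  have hY : ∀ t, ∀ᶠ l : ℝ in atTop, ∀ u, ‖yosida J l t u‖ ≤ ‖u‖ := fun t => by
    filter_upwards [eventually_gt_atTop 0] with l hl
    exact (hJ.yosida_isContractionSemigroup hl).norm_le t
  have hcau : ∀ (t : ℝ≥0) u, CauchySeq fun l => yosida J l t u := by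
    intro t
    refine cauchySeq_of_denseRange (hY t) hJ.dense fun v => ?_
    refine Metric.cauchySeq_iff.2 fun ε hε => ?_
    obtain ⟨N, hN⟩ := Metric.cauchySeq_iff.1 (hJ.tendsto_yosidaGen v).cauchySeq
      (ε / (t + 1)) (by positivity)
    refine ⟨max N 1, fun l hl m hm => ?_⟩
    have h1 := hN l (le_trans (le_max_left _ _) hl) m (le_trans (le_max_left _ _) hm)
    have hl' : 0 < l := lt_of_lt_of_le one_pos (le_trans (le_max_right _ _) hl)
    have hm' : 0 < m := lt_of_lt_of_le one_pos (le_trans (le_max_right _ _) hm)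
    rw [dist_eq_norm] at h1 ⊢
    have h2 := hJ.norm_yosida_sub_le hl' hm' t (J 1 v)
    rw [lt_div_iff₀ (by positivity)] at h1
    nlinarith [norm_nonneg (yosidaGen J l (J 1 v) - yosidaGen J m (J 1 v))]
  have hlim : ∀ t, ∃ P : X →L[ℝ] X, (∀ u, Tendsto (fun l => yosida J l t u) atTop (𝓝 (P u))) ∧
      ∀ u, ‖P u‖ ≤ ‖u‖ := by
    intro t
    choose f hf using fun u => cauchySeq_tendsto_of_complete (hcau t u)
    obtain ⟨P, hP, hP'⟩ := exists_clm_of_tendsto hf (hY t)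
    exact ⟨P, fun u => by rw [hP]; exact hf u, hP'⟩
  choose P hP hPn using hlim
  -- Letting m → ∞ in `norm_yosida_sub_le` keeps the factor t. Dividing by t controls the difference
  -- quotients of `P`; letting t → 0 gives strong continuity.
  have hbound : ∀ l, 0 < l → ∀ t v, ‖yosida J l t (J 1 v) - P t (J 1 v)‖ ≤
      t * ‖yosidaGen J l (J 1 v) - (J 1 v - v)‖ := by
    intro l hl t v
    refine le_of_tendsto_of_tendsto ((tendsto_const_nhds.sub (hP t _)).norm)
      (((tendsto_const_nhds.sub (hJ.tendsto_yosidaGen v)).norm).const_mul _) ?_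
    filter_upwards [eventually_gt_atTop 0] with m hm
    exact hJ.norm_yosida_sub_le hl hm t _
  have hgen : ∀ v, HasGenerator P (J 1 v) (J 1 v - v) := by
    intro v
    refine Metric.tendsto_nhds.2 fun ε hε => ?_
    have h1 := Metric.tendsto_nhds.1 (hJ.tendsto_yosidaGen v) (ε / 3) (by positivity)
    obtain ⟨l, hl1, hl⟩ := (h1.and (eventually_gt_atTop 0)).exists
    filter_upwards [Metric.tendsto_nhds.1 (hasGenerator_yosida J l (J 1 v)) (ε / 3)
      (by positivity), self_mem_nhdsWithin] with t ht htpos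
    have htpos' : 0 < (t : ℝ) := NNReal.coe_pos.2 htpos
    have h2 : dist ((t : ℝ)⁻¹ • (P t (J 1 v) - J 1 v))
        ((t : ℝ)⁻¹ • (yosida J l t (J 1 v) - J 1 v)) ≤ dist (yosidaGen J l (J 1 v)) (J 1 v - v) := by
      rw [dist_comm, dist_eq_norm, ← smul_sub, sub_sub_sub_cancel_right, norm_smul, norm_inv,
        Real.norm_of_nonneg htpos'.le, inv_mul_le_iff₀ htpos', dist_eq_norm]
      exact hbound l hl t v
    have := dist_triangle4 ((t : ℝ)⁻¹ • (P t (J 1 v) - J 1 v))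
      ((t : ℝ)⁻¹ • (yosida J l t (J 1 v) - J 1 v)) (yosidaGen J l (J 1 v)) (J 1 v - v)
    linarith
  refine ⟨P, ⟨⟨?_, fun s t => ?_, ?_⟩, hPn⟩, hP, hgen⟩
  · ext u
    refine tendsto_nhds_unique (hP 0 u) ?_
    simp [yosida]
  · ext u
    refine tendsto_nhds_unique (hP (s + t) u) ?_
    -- Both factors of the product depend on l; contractivity of the outer one absorbs the error of
    -- the inner one.
    have h1 : Tendsto (fun l => yosida J l s (yosida J l t u - P t u)) atTop (𝓝 0) := by
      have h0 := ((hP t u).sub_const (P t u)).norm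
      rw [sub_self, norm_zero] at h0
      refine squeeze_zero_norm' ?_ h0
      filter_upwards [hY s] with l hl using hl _
    have h2 := h1.add (hP s (P t u))
    rw [zero_add] at h2
    refine h2.congr' ?_
    filter_upwards [eventually_gt_atTop 0] with l hl
    rw [map_sub, sub_add_cancel, (hJ.yosida_isContractionSemigroup hl).map_add]
    rfl
  · refine tendsto_of_denseRange (G := ContinuousLinearMap.id ℝ X) (Eventually.of_forall hPn)
      hJ.dense (fun _ => le_rfl) fun v => ?_
    obtain ⟨l, hl⟩ := eventually_gt_atTop (0 : ℝ) |>.exists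
    have h1 := (hJ.yosida_isContractionSemigroup hl).strongly_continuous (J 1 v)
    have h2 : Tendsto (fun t : ℝ≥0 => P t (J 1 v) - yosida J l t (J 1 v)) (𝓝 0) (𝓝 0) := by
      have h0 : Tendsto (fun t : ℝ≥0 => t * ‖yosidaGen J l (J 1 v) - (J 1 v - v)‖)
          (𝓝 0) (𝓝 0) := by
        have : Continuous fun t : ℝ≥0 => (t : ℝ) * ‖yosidaGen J l (J 1 v) - (J 1 v - v)‖ := by
          fun_prop
        exact this.tendsto' 0 0 (by simp)
      refine squeeze_zero_norm (fun t => ?_) h0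
      rw [norm_sub_rev]
      exact hbound l hl t v
    simpa using h2.add h1

end IsResolventFamily

variable [CompleteSpace X] {T : ℝ≥0 → X →L[ℝ] X} {J : ℝ → X →L[ℝ] X}

theorem IsContractionSemigroup.isResolventFamily (hT : IsContractionSemigroup T)
    (hJ : ∀ l, 0 < l → ∀ u, J l u = laplace T l u) : IsResolventFamily J where
  sub_eq hl hm v := by
    rw [hJ _ hl, hJ _ hm, hJ _ hl, hT.laplace_sub_laplace hl hm]
  norm_le hl v := by
    rw [hJ _ hl, mul_comm, ← le_div_iff₀ hl, div_eq_inv_mul]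
    exact hT.norm_laplace_le hl v
  dense := by
    rw [show ⇑(J 1) = laplace T 1 from funext (hJ 1 one_pos)]
    exact fun u => hT.mem_closure_range_laplace one_pos u

/-- A semigroup is the limit of its Yosida approximations. -/
theorem IsContractionSemigroup.tendsto_yosida (hT : IsContractionSemigroup T)
    (hJ : ∀ l, 0 < l → ∀ u, J l u = laplace T l u) (t : ℝ≥0) (u : X) :
    Tendsto (fun l => yosida J l t u) atTop (𝓝 (T t u)) := by
  have hR := hT.isResolventFamily hJ
  refine tendsto_of_denseRange ?_ hR.dense (hT.norm_le t) (fun v => ?_) u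
  · filter_upwards [eventually_gt_atTop 0] with l hl
    exact (hR.yosida_isContractionSemigroup hl).norm_le t
  rw [tendsto_iff_norm_sub_tendsto_zero]
  have h0 := (((hR.tendsto_yosidaGen v).sub_const (J 1 v - v)).norm).const_mul (t : ℝ)
  rw [sub_self, norm_zero, mul_zero] at h0
  refine squeeze_zero' (Eventually.of_forall fun _ => norm_nonneg _) ?_ h0
  filter_upwards [eventually_gt_atTop 0] with l hl
  refine norm_sub_le_of_commute (hR.yosida_isContractionSemigroup hl) hT (fun s => ?_)
    (hasGenerator_yosida J l _) ?_ t
  · refine Commute.exp_left (Commute.smul_left ?_ _)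
    refine ((Commute.smul_left ?_ _).sub_left ((Commute.one_left _).smul_left _))
    ext u
    change J l (T s u) = T s (J l u)
    rw [hJ l hl, hJ l hl, hT.apply_laplace_eq_laplace_apply hl]
  · have := hT.hasGenerator_laplace one_pos v
    rwa [one_smul, ← hJ 1 one_pos] at this

end Yosida

/-! ### Functionals preserved by Yosida approximations. -/

section Functional

variable {X : Type*} [NormedAddCommGroup X] [NormedSpace ℝ X]

/-- Functionals preserved by `l • J l` are preserved by the Yosida approximations. -/
theorem map_yosida_eq [CompleteSpace X] {J : ℝ → X →L[ℝ] X} {l : ℝ} {φ : X →L[ℝ] ℝ}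
    (h : ∀ u, l * φ (J l u) = φ u) (t : ℝ≥0) (u : X) : φ (yosida J l t u) = φ u := by
  have hpow : ∀ n : ℕ, φ ((((t * l ^ 2) • J l) ^ n) u) = (l * t) ^ n * φ u := by
    intro n
    induction n with
    | zero => simp
    | succ n ih =>
      rw [pow_succ' _ n, pow_succ' _ n, mul_assoc, ← ih, ← h ((((t * l ^ 2) • J l) ^ n) u)]
      change φ ((t * l ^ 2) • J l ((((t * l ^ 2) • J l) ^ n) u)) = _
      rw [map_smul, smul_eq_mul]
      ring
  rw [yosida_apply, map_smul, smul_eq_mul]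
  have h1 := (hasSum_exp_apply ((t * l ^ 2) • J l) u).mapL φ
  have h2 : φ (NormedSpace.exp ((t * l ^ 2) • J l) u) = Real.exp (l * t) * φ u := by
    refine HasSum.unique ?_ ((hasSum_real_exp (l * t)).mul_right (φ u))
    simpa only [map_smul, hpow, smul_eq_mul, mul_assoc] using h1
  rw [h2, ← mul_assoc, ← Real.exp_add, neg_add_cancel, Real.exp_zero, one_mul]

end Functional

/-! ### Positive operators and norms additive on the cone. -/

section Order

variable {X : Type*} [NormedAddCommGroup X] [NormedSpace ℝ X] [Lattice X]

theorem pow_apply_nonneg {S : X →L[ℝ] X} (hS : ∀ u, 0 ≤ u → 0 ≤ S u) (n : ℕ) {u : X}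
    (hu : 0 ≤ u) : 0 ≤ (S ^ n) u := by
  induction n with
  | zero => simpa
  | succ n ih => rw [pow_succ']; exact hS _ ih

theorem map_nonneg_of_eq_norm {φ : X →L[ℝ] ℝ} (hφ : ∀ u, 0 ≤ u → φ u = ‖u‖) {u : X}
    (hu : 0 ≤ u) : 0 ≤ φ u := (hφ u hu) ▸ norm_nonneg u

variable [IsOrderedAddMonoid X]

theorem map_le_map_of_eq_norm {φ : X →L[ℝ] ℝ} (hφ : ∀ u, 0 ≤ u → φ u = ‖u‖) {u v : X}
    (h : u ≤ v) : φ u ≤ φ v := by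
  rw [← sub_nonneg, ← map_sub]
  exact map_nonneg_of_eq_norm hφ (sub_nonneg.2 h)

theorem norm_le_norm_of_eq_norm {φ : X →L[ℝ] ℝ} (hφ : ∀ u, 0 ≤ u → φ u = ‖u‖) {u v : X}
    (hu : 0 ≤ u) (h : u ≤ v) : ‖u‖ ≤ ‖v‖ := by
  rw [← hφ u hu, ← hφ v (hu.trans h)]
  exact map_le_map_of_eq_norm hφ h

theorem map_le_map_of_nonneg {L : X →ₗ[ℝ] X} (hL : ∀ u, 0 ≤ u → 0 ≤ L u) {x y : X} (h : x ≤ y) :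
    L x ≤ L y := by
  rw [← sub_nonneg, ← map_sub]
  exact hL _ (sub_nonneg.2 h)

theorem eq_of_eqOn_nonneg {S T : X →L[ℝ] X} (h : ∀ u, 0 ≤ u → S u = T u) : S = T := by
  ext u
  rw [← posPart_sub_negPart u, map_sub, map_sub, h _ (posPart_nonneg u), h _ (negPart_nonneg u)]

theorem exists_tendsto_of_nonneg {ι : Type*} {l : Filter ι} {F : ι → X →L[ℝ] X}
    (h : ∀ u, 0 ≤ u → ∃ v, Tendsto (fun i => F i u) l (𝓝 v)) (u : X) :
    ∃ v, Tendsto (fun i => F i u) l (𝓝 v) := by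
  obtain ⟨v, hv⟩ := h _ (posPart_nonneg u)
  obtain ⟨w, hw⟩ := h _ (negPart_nonneg u)
  refine ⟨v - w, (hv.sub hw).congr fun i => ?_⟩
  rw [← map_sub, posPart_sub_negPart]

theorem tendsto_zero_of_nonneg {ι : Type*} {l : Filter ι} {F : ι → X →L[ℝ] X}
    (h : ∀ u, 0 ≤ u → Tendsto (fun i => F i u) l (𝓝 0)) (u : X) :
    Tendsto (fun i => F i u) l (𝓝 0) := by
  have := (h _ (posPart_nonneg u)).sub (h _ (negPart_nonneg u))
  rw [sub_zero] at this
  refine this.congr fun i => ?_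
  rw [← map_sub, posPart_sub_negPart]

theorem pow_apply_le_pow_apply {S T : X →L[ℝ] X} (hS : ∀ u, 0 ≤ u → 0 ≤ S u)
    (hST : ∀ u, 0 ≤ u → S u ≤ T u) (n : ℕ) {u : X} (hu : 0 ≤ u) : (S ^ n) u ≤ (T ^ n) u := by
  induction n with
  | zero => simp
  | succ n ih =>
    rw [pow_succ', pow_succ']
    exact (hST _ (pow_apply_nonneg hS n hu)).trans (map_le_map_of_nonneg (L := (T : X →ₗ[ℝ] X))
      (fun u hu => (hS u hu).trans (hST u hu)) ih)

section AdditiveNorm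

variable {φ : X →L[ℝ] ℝ}

/-- Monotone norm-bounded nets converge when the norm is additive on the positive cone. -/
theorem exists_tendsto_of_monotone [CompleteSpace X] (hφ : ∀ u, 0 ≤ u → φ u = ‖u‖)
    {ι : Type*} [SemilatticeSup ι] [Nonempty ι]
    {f : ι → X} (a : ι) (hf : ∀ i j, a ≤ i → i ≤ j → f i ≤ f j) {C : ℝ}
    (hC : ∀ i, a ≤ i → φ (f i) ≤ C) : ∃ v, Tendsto f atTop (𝓝 v) := by
  refine cauchySeq_tendsto_of_complete (Metric.cauchySeq_iff'.2 fun ε hε => ?_)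
  have hmono : Monotone fun i => φ (f (a ⊔ i)) := fun i j hij =>
    map_le_map_of_eq_norm hφ (hf _ _ le_sup_left (sup_le_sup_left hij a))
  have hbdd : BddAbove (Set.range fun i => φ (f (a ⊔ i))) :=
    ⟨C, by rintro _ ⟨i, rfl⟩; exact hC _ le_sup_left⟩
  obtain ⟨N, hN⟩ := Metric.cauchySeq_iff'.1 (tendsto_atTop_ciSup hmono hbdd).cauchySeq ε hε
  refine ⟨a ⊔ N, fun i hi => ?_⟩
  have h1 := hN i (le_sup_right.trans hi)
  have hai : a ≤ i := le_sup_left.trans hi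
  rw [dist_eq_norm, sup_eq_right.2 hai, ← map_sub] at h1
  rw [dist_eq_norm]
  -- The increment is positive, so its norm is the increment of `φ`: a Cauchy estimate for real
  -- numbers becomes one in `X`.
  rw [hφ _ (sub_nonneg.2 (hf _ _ le_sup_left hi)), norm_norm] at h1
  exact h1

/-- Decreasing sequences of positive elements converge when the norm is additive on the positive
cone. -/
theorem exists_tendsto_of_antitone [CompleteSpace X] (hφ : ∀ u, 0 ≤ u → φ u = ‖u‖)
    {f : ℕ → X} (hf : Antitone f)
    (h0 : ∀ n, 0 ≤ f n) : ∃ v, Tendsto f atTop (𝓝 v) := by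
  obtain ⟨v, hv⟩ := exists_tendsto_of_monotone hφ (f := fun n => -f n) (C := 0) 0
    (fun i j _ hij => neg_le_neg (hf hij))
    (fun i _ => by rw [map_neg]; exact neg_nonpos.2 (map_nonneg_of_eq_norm hφ (h0 i)))
  exact ⟨-v, by simpa using hv.neg⟩

end AdditiveNorm

variable [HasSolidNorm X]

/-- A positive operator is bounded by its bound on the positive cone. -/
theorem norm_map_le_of_nonneg {L : X →ₗ[ℝ] X} (hL : ∀ u, 0 ≤ u → 0 ≤ L u) {c : ℝ}
    (hc : ∀ u, 0 ≤ u → ‖L u‖ ≤ c * ‖u‖) (u : X) : ‖L u‖ ≤ c * ‖u‖ := by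
  have h1 : |L u| ≤ L |u| := by
    refine abs_le'.2 ⟨map_le_map_of_nonneg hL (le_abs_self u), ?_⟩
    rw [← map_neg]
    exact map_le_map_of_nonneg hL (neg_le_abs u)
  have h2 : ‖L u‖ ≤ ‖L |u|‖ :=
    norm_le_norm_of_abs_le_abs (by rwa [abs_of_nonneg (hL _ (abs_nonneg u))])
  simpa only [norm_abs_eq_norm] using h2.trans (hc _ (abs_nonneg u))

section

variable [IsOrderedModule ℝ X]

theorem laplace_nonneg {T : ℝ≥0 → X →L[ℝ] X} (hT : ∀ t u, 0 ≤ u → 0 ≤ T t u) (l : ℝ) {u : X}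
    (hu : 0 ≤ u) : 0 ≤ laplace T l u :=
  integral_nonneg fun _ => smul_nonneg (Real.exp_pos _).le (hT _ u hu)

variable [CompleteSpace X]

theorem yosida_nonneg {J : ℝ → X →L[ℝ] X} {l : ℝ} (hJ : ∀ u, 0 ≤ u → 0 ≤ J l u) (t : ℝ≥0)
    {u : X} (hu : 0 ≤ u) : 0 ≤ yosida J l t u := by
  rw [yosida_apply]
  refine smul_nonneg (Real.exp_pos _).le ((hasSum_exp_apply _ u).nonneg fun n => ?_)
  refine smul_nonneg (by positivity) (pow_apply_nonneg (fun v hv => ?_) n hu)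
  exact smul_nonneg (by positivity) (hJ v hv)

/-- Both sides carry the same scalar exponential, so the two power series can be compared term by
term. -/
theorem yosida_le_yosida {I J : ℝ → X →L[ℝ] X} {l : ℝ} (hI : ∀ u, 0 ≤ u → 0 ≤ I l u)
    (hIJ : ∀ u, 0 ≤ u → I l u ≤ J l u) (t : ℝ≥0) {u : X} (hu : 0 ≤ u) :
    yosida I l t u ≤ yosida J l t u := by
  rw [yosida_apply, yosida_apply]
  refine smul_le_smul_of_nonneg_left ?_ (Real.exp_pos _).le
  refine hasSum_le (fun n => ?_) (hasSum_exp_apply _ u) (hasSum_exp_apply _ u)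
  refine smul_le_smul_of_nonneg_left (pow_apply_le_pow_apply (fun v hv => ?_) (fun v hv => ?_) n hu)
    (by positivity)
  · exact smul_nonneg (by positivity) (hI v hv)
  · exact smul_le_smul_of_nonneg_left (hIJ v hv) (by positivity)

end

end Order

/-! ### Kato's series and the minimal semigroup. -/

section Kato

variable {X : Type*} [NormedAddCommGroup X] [NormedSpace ℝ X]

/-- The partial sums of the series `∑ R l (F l) ^ n`. -/
def katoSum (R F : ℝ → X →L[ℝ] X) (l : ℝ) (N : ℕ) : X →L[ℝ] X :=
  ∑ n ∈ Finset.range N, R l * F l ^ n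

theorem katoSum_apply (R F : ℝ → X →L[ℝ] X) (l : ℝ) (N : ℕ) (v : X) :
    katoSum R F l N v = ∑ n ∈ Finset.range N, R l ((F l ^ n) v) := by
  simp [katoSum]

variable [Lattice X]

/-- A generator `a` of positive contractions with domain `D` and resolvents `R l = r l`, and a
positive perturbation `b` such that `a + b` preserves the functional `φ`. Here `F l = b R l`. -/
structure IsKatoPair (φ : X →L[ℝ] ℝ) (D : Submodule ℝ X) (a b : D →ₗ[ℝ] X)
    (r : ℝ → X →ₗ[ℝ] D) (R F : ℝ → X →L[ℝ] X) : Prop where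
  norm_eq : ∀ u, 0 ≤ u → φ u = ‖u‖
  R_eq : ∀ {l : ℝ}, 0 < l → ∀ u, R l u = r l u
  F_eq : ∀ {l : ℝ}, 0 < l → ∀ u, F l u = b (r l u)
  right_inv : ∀ {l : ℝ}, 0 < l → ∀ u, l • (r l u : X) - a (r l u) = u
  left_inv : ∀ {l : ℝ}, 0 < l → ∀ w : D, r l (l • (w : X) - a w) = w
  R_nonneg : ∀ {l : ℝ}, 0 < l → ∀ u, 0 ≤ u → 0 ≤ R l u
  b_nonneg : ∀ w : D, 0 ≤ (w : X) → 0 ≤ b w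
  map_add_eq_zero : ∀ w : D, 0 ≤ (w : X) → φ (a w + b w) = 0
  dense : Dense (D : Set X)

namespace IsKatoPair

variable {φ : X →L[ℝ] ℝ} {D : Submodule ℝ X} {a b : D →ₗ[ℝ] X}
  {r : ℝ → X →ₗ[ℝ] D} {R F : ℝ → X →L[ℝ] X} {l m : ℝ}

theorem F_nonneg (h : IsKatoPair φ D a b r R F) (hl : 0 < l) (u : X) (hu : 0 ≤ u) :
    0 ≤ F l u := by
  rw [h.F_eq hl]
  exact h.b_nonneg _ (by rw [← h.R_eq hl]; exact h.R_nonneg hl u hu)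

/-- The balance identity: apply `φ` to (l - a) r_l u = u and use that a + b has no mass on the
positive element r_l u. -/
theorem map_F (h : IsKatoPair φ D a b r R F) (hl : 0 < l) {u : X} (hu : 0 ≤ u) :
    φ (F l u) = φ u - l * φ (R l u) := by
  have h1 := h.map_add_eq_zero (r l u) (by rw [← h.R_eq hl]; exact h.R_nonneg hl u hu)
  have h2 := congrArg φ (h.right_inv hl u)
  rw [map_add, ← h.F_eq hl] at h1
  rw [map_sub, map_smul, smul_eq_mul, ← h.R_eq hl] at h2
  linarith

theorem map_F_le (h : IsKatoPair φ D a b r R F) (hl : 0 < l) {u : X} (hu : 0 ≤ u) :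
    φ (F l u) ≤ φ u := by
  rw [h.map_F hl hu]
  have := mul_nonneg hl.le (map_nonneg_of_eq_norm h.norm_eq (h.R_nonneg hl u hu))
  linarith

/-- Stated in `D` rather than `X` so that the unbounded `b` can be applied to it, as in `F_anti`. -/
theorem resolvent_sub (h : IsKatoPair φ D a b r R F) (hl : 0 < l) (hm : 0 < m) (v : X) :
    r l v - r m v = (m - l) • r l (R m v) := by
  have h1 := h.left_inv hl (r m v)
  have h2 : l • (r m v : X) - a (r m v) = v + (l - m) • R m v := by
    rw [h.R_eq hm]
    nth_rewrite 3 [← h.right_inv hm v]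
    rw [sub_smul]
    abel
  rw [h2, map_add, map_smul] at h1
  nth_rewrite 1 [← h1]
  rw [← neg_sub l m, neg_smul]
  abel

/-- Telescoping: l - a - b sends r_l F_l^n v to F_l^n v - F_l^(n+1) v. The witness in `D` is needed
since the limit of the partial sums may leave `D`. -/
theorem exists_coe_eq_katoSum (h : IsKatoPair φ D a b r R F) (hl : 0 < l) (N : ℕ) (v : X) :
    ∃ w : D, (w : X) = katoSum R F l N v ∧ l • (w : X) - a w - b w = v - (F l ^ N) v := by
  induction N with
  | zero => exact ⟨0, by simp [katoSum]⟩
  | succ N ih =>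
    obtain ⟨w, hw, hw'⟩ := ih
    refine ⟨w + r l ((F l ^ N) v), ?_, ?_⟩
    · rw [katoSum_apply, Finset.sum_range_succ, ← katoSum_apply, Submodule.coe_add, hw,
        h.R_eq hl]
    · have h1 := h.right_inv hl ((F l ^ N) v)
      have h2 : (F l ^ (N + 1)) v = b (r l ((F l ^ N) v)) := by
        rw [pow_succ', ← h.F_eq hl]; rfl
      rw [Submodule.coe_add, map_add, map_add, smul_add, h2]
      calc _ = (l • (w : X) - a w - b w) +
            (l • (r l ((F l ^ N) v) : X) - a (r l ((F l ^ N) v))) - b (r l ((F l ^ N) v)) := by abel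
        _ = _ := by rw [hw', h1]; abel

theorem katoSum_succ_apply (h : IsKatoPair φ D a b r R F) (hl : 0 < l) (N : ℕ) (w : D) :
    katoSum R F l (N + 1) (l • (w : X) - a w) = w + katoSum R F l N (b w) := by
  rw [katoSum_apply, Finset.sum_range_succ', add_comm, katoSum_apply]
  congr 1
  · rw [pow_zero, h.R_eq hl]
    exact congrArg _ (h.left_inv hl w)
  · refine Finset.sum_congr rfl fun n _ => ?_
    rw [pow_succ]
    change R l ((F l ^ n) (F l _)) = _
    rw [h.F_eq hl, h.left_inv hl]

theorem F_pow_nonneg (h : IsKatoPair φ D a b r R F) (hl : 0 < l) (n : ℕ) {u : X} (hu : 0 ≤ u) :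
    0 ≤ (F l ^ n) u :=
  pow_apply_nonneg (h.F_nonneg hl) n hu

variable [IsOrderedAddMonoid X]

theorem katoSum_nonneg (h : IsKatoPair φ D a b r R F) (hl : 0 < l) (N : ℕ) (u : X)
    (hu : 0 ≤ u) : 0 ≤ katoSum R F l N u := by
  rw [katoSum_apply]
  exact Finset.sum_nonneg fun n _ => h.R_nonneg hl _ (h.F_pow_nonneg hl n hu)

theorem katoSum_mono (h : IsKatoPair φ D a b r R F) (hl : 0 < l) {u : X} (hu : 0 ≤ u) :
    Monotone fun N => katoSum R F l N u := by
  refine monotone_nat_of_le_succ fun N => ?_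
  rw [katoSum_apply, katoSum_apply, Finset.sum_range_succ]
  exact le_add_of_nonneg_right (h.R_nonneg hl _ (h.F_pow_nonneg hl N hu))

theorem map_katoSum (h : IsKatoPair φ D a b r R F) (hl : 0 < l) (N : ℕ) {u : X} (hu : 0 ≤ u) :
    l * φ (katoSum R F l N u) = φ u - φ ((F l ^ N) u) := by
  obtain ⟨w, hw, hw'⟩ := h.exists_coe_eq_katoSum hl N u
  have h1 := h.map_add_eq_zero w (by rw [hw]; exact h.katoSum_nonneg hl N u hu)
  have h2 := congrArg φ hw'
  rw [map_add] at h1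
  rw [map_sub, map_sub, map_sub, map_smul, smul_eq_mul, hw] at h2
  linarith

theorem map_katoSum_le (h : IsKatoPair φ D a b r R F) (hl : 0 < l) (N : ℕ) {u : X}
    (hu : 0 ≤ u) : l * φ (katoSum R F l N u) ≤ φ u := by
  rw [h.map_katoSum hl N hu]
  have := map_nonneg_of_eq_norm h.norm_eq (h.F_pow_nonneg hl N hu)
  linarith

section OrderedModule

variable [IsOrderedModule ℝ X]

theorem R_anti (h : IsKatoPair φ D a b r R F) (hl : 0 < l) (hlm : l ≤ m) (u : X) (hu : 0 ≤ u) :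
    R m u ≤ R l u := by
  have hm := hl.trans_le hlm
  have h1 := congrArg (fun w : D => (w : X)) (h.resolvent_sub hl hm u)
  simp only [Submodule.coe_sub, Submodule.coe_smul, ← h.R_eq hl, ← h.R_eq hm] at h1
  rw [← sub_nonneg, h1]
  exact smul_nonneg (sub_nonneg.2 hlm) (h.R_nonneg hl _ (h.R_nonneg hm u hu))

theorem F_anti (h : IsKatoPair φ D a b r R F) (hl : 0 < l) (hlm : l ≤ m) (u : X) (hu : 0 ≤ u) :
    F m u ≤ F l u := by
  have hm := hl.trans_le hlm
  have h1 := congrArg b (h.resolvent_sub hl hm u)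
  rw [map_sub, map_smul, ← h.F_eq hl, ← h.F_eq hm, ← h.F_eq hl] at h1
  rw [← sub_nonneg, h1]
  exact smul_nonneg (sub_nonneg.2 hlm) (h.F_nonneg hl _ (h.R_nonneg hm u hu))

theorem F_pow_anti (h : IsKatoPair φ D a b r R F) (hl : 0 < l) (hlm : l ≤ m) (n : ℕ) {u : X}
    (hu : 0 ≤ u) : (F m ^ n) u ≤ (F l ^ n) u :=
  pow_apply_le_pow_apply (h.F_nonneg (hl.trans_le hlm)) (h.F_anti hl hlm) n hu

theorem katoSum_anti (h : IsKatoPair φ D a b r R F) (hl : 0 < l) (hlm : l ≤ m) (N : ℕ) (u : X)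
    (hu : 0 ≤ u) : katoSum R F m N u ≤ katoSum R F l N u := by
  have hm := hl.trans_le hlm
  rw [katoSum_apply, katoSum_apply]
  refine Finset.sum_le_sum fun n _ => ?_
  exact (h.R_anti hl hlm _ (h.F_pow_nonneg hm n hu)).trans
    (map_le_map_of_nonneg (L := (R l : X →ₗ[ℝ] X)) (h.R_nonneg hl) (h.F_pow_anti hl hlm n hu))

end OrderedModule

variable [HasSolidNorm X]

theorem norm_F_le (h : IsKatoPair φ D a b r R F) (hl : 0 < l) (u : X) : ‖F l u‖ ≤ ‖u‖ := by
  have := norm_map_le_of_nonneg (L := (F l : X →ₗ[ℝ] X)) (h.F_nonneg hl) (c := 1) (fun u hu => by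
    have := h.map_F_le hl hu
    rwa [h.norm_eq u hu, h.norm_eq _ (h.F_nonneg hl u hu), ← one_mul ‖u‖] at this) u
  rwa [one_mul] at this

theorem norm_katoSum_le (h : IsKatoPair φ D a b r R F) (hl : 0 < l) (N : ℕ) (u : X) :
    ‖katoSum R F l N u‖ ≤ l⁻¹ * ‖u‖ :=
  norm_map_le_of_nonneg (L := (katoSum R F l N : X →ₗ[ℝ] X)) (h.katoSum_nonneg hl N)
    (fun u hu => by
      rw [← h.norm_eq u hu, inv_mul_eq_div, le_div_iff₀ hl, mul_comm]
      have := h.map_katoSum_le hl N hu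
      rwa [h.norm_eq _ (h.katoSum_nonneg hl N u hu)] at this) u

variable [CompleteSpace X]

theorem exists_katoResolvent (h : IsKatoPair φ D a b r R F) :
    ∃ G : ℝ → X →L[ℝ] X, ∀ l, 0 < l →
      ∀ u, Tendsto (fun N => katoSum R F l N u) atTop (𝓝 (G l u)) := by
  have key : ∀ l : ℝ, ∃ G : X →L[ℝ] X, 0 < l →
      ∀ u, Tendsto (fun N => katoSum R F l N u) atTop (𝓝 (G u)) := by
    intro l
    by_cases hl : 0 < l
    swap
    · exact ⟨0, fun h => absurd h hl⟩
    have h1 : ∀ u, ∃ v, Tendsto (fun N => katoSum R F l N u) atTop (𝓝 v) := by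
      refine exists_tendsto_of_nonneg fun u hu => ?_
      refine exists_tendsto_of_monotone h.norm_eq 0 (C := l⁻¹ * φ u)
        (fun i j _ hij => h.katoSum_mono hl hu hij) fun i _ => ?_
      rw [inv_mul_eq_div, le_div_iff₀ hl, mul_comm]
      exact h.map_katoSum_le hl i hu
    choose f hf using h1
    -- The factor l makes the partial sums contractions; it is removed again in the witness.
    obtain ⟨P, hP, -⟩ := exists_clm_of_tendsto (F := fun N => l • katoSum R F l N)
      (fun u => (hf u).const_smul l) (Eventually.of_forall fun N u => by
        rw [smul_apply, norm_smul, Real.norm_of_nonneg hl.le, ← le_div_iff₀' hl, div_eq_inv_mul]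
        exact h.norm_katoSum_le hl N u)
    refine ⟨l⁻¹ • P, fun _ u => ?_⟩
    rw [smul_apply, hP, inv_smul_smul₀ hl.ne']
    exact hf u
  choose G hG using key
  exact ⟨G, hG⟩

end IsKatoPair

/-- A Kato pair together with the limits `G l` of the series `∑ R l (F l) ^ n`. -/
structure IsKatoResolvent (φ : X →L[ℝ] ℝ) (D : Submodule ℝ X) (a b : D →ₗ[ℝ] X)
    (r : ℝ → X →ₗ[ℝ] D) (R F G : ℝ → X →L[ℝ] X) : Prop extends IsKatoPair φ D a b r R F where
  tendsto : ∀ {l : ℝ}, 0 < l → ∀ u, Tendsto (fun N => katoSum R F l N u) atTop (𝓝 (G l u))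

namespace IsKatoResolvent

variable {φ : X →L[ℝ] ℝ} {D : Submodule ℝ X} {a b : D →ₗ[ℝ] X}
  {r : ℝ → X →ₗ[ℝ] D} {R F G : ℝ → X →L[ℝ] X} {l m : ℝ}

/-- Since F_l (l - a) w = b w, the series at (l - a) w is w plus the series at b w. -/
theorem apply_sub (h : IsKatoResolvent φ D a b r R F G) (hl : 0 < l) (w : D) :
    G l (l • (w : X) - a w - b w) = w := by
  have h1 := ((tendsto_add_atTop_iff_nat 1).2 (h.tendsto hl (l • (w : X) - a w)))
  simp only [h.katoSum_succ_apply hl] at h1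
  have h2 := tendsto_nhds_unique h1 ((h.tendsto hl (b w)).const_add (w : X))
  rw [map_sub, h2, add_sub_cancel_right]

theorem apply_sub_pow (h : IsKatoResolvent φ D a b r R F G) (hl : 0 < l) (N : ℕ) (v : X) :
    G l (v - (F l ^ N) v) = katoSum R F l N v := by
  obtain ⟨w, hw, hw'⟩ := h.exists_coe_eq_katoSum hl N v
  rw [← hw', h.apply_sub hl, hw]

/-- G_l F_l^N v is the tail of the convergent series for G_l v. -/
theorem tendsto_apply_pow (h : IsKatoResolvent φ D a b r R F G) (hl : 0 < l) (v : X) :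
    Tendsto (fun N => G l ((F l ^ N) v)) atTop (𝓝 0) := by
  have h1 := (tendsto_const_nhds (x := G l v)).sub (h.tendsto hl v)
  rw [sub_self] at h1
  refine h1.congr fun N => ?_
  rw [← h.apply_sub_pow hl, map_sub, sub_sub_cancel]

variable [IsOrderedAddMonoid X]

/-- The minimal semigroup preserves `φ` when the powers of `F l` tend to zero. -/
theorem map_semigroup_eq [CompleteSpace X] (h : IsKatoResolvent φ D a b r R F G)
    {P : ℝ≥0 → X →L[ℝ] X}
    (hP : ∀ t u, Tendsto (fun l => yosida G l t u) atTop (𝓝 (P t u)))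
    (hF : ∀ l, 0 < l → ∀ u, 0 ≤ u → Tendsto (fun N => φ ((F l ^ N) u)) atTop (𝓝 0))
    (t : ℝ≥0) (u : X) : φ (P t u) = φ u := by
  have hpos : ∀ l, 0 < l → ∀ u, 0 ≤ u → l * φ (G l u) = φ u := by
    intro l hl u hu
    have h1 := (((φ.continuous.tendsto _).comp (h.tendsto hl u)).const_mul l)
    have h2 := (tendsto_const_nhds (x := φ u)).sub (hF l hl u hu)
    rw [sub_zero] at h2
    refine tendsto_nhds_unique h1 (h2.congr fun N => ?_)
    rw [Function.comp_apply, h.map_katoSum hl N hu]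
  have hall : ∀ l, 0 < l → ∀ u, l * φ (G l u) = φ u := by
    intro l hl u
    rw [← posPart_sub_negPart u, map_sub, map_sub, map_sub, mul_sub, hpos l hl _ (posPart_nonneg u),
      hpos l hl _ (negPart_nonneg u)]
  refine tendsto_nhds_unique ((φ.continuous.tendsto _).comp (hP t u)) ?_
  refine tendsto_const_nhds.congr' ?_
  filter_upwards [eventually_gt_atTop 0] with l hl
  exact (map_yosida_eq (hall l hl) t u).symm

variable [HasSolidNorm X]

theorem katoSum_le (h : IsKatoResolvent φ D a b r R F G) (hl : 0 < l) (N : ℕ) {u : X}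
    (hu : 0 ≤ u) : katoSum R F l N u ≤ G l u :=
  (h.katoSum_mono hl hu).ge_of_tendsto (h.tendsto hl u) N

theorem nonneg (h : IsKatoResolvent φ D a b r R F G) (hl : 0 < l) (u : X) (hu : 0 ≤ u) :
    0 ≤ G l u :=
  (h.katoSum_nonneg hl 0 u hu).trans (h.katoSum_le hl 0 hu)

theorem norm_le (h : IsKatoResolvent φ D a b r R F G) (hl : 0 < l) (u : X) :
    l * ‖G l u‖ ≤ ‖u‖ := by
  rw [← le_div_iff₀' hl, div_eq_inv_mul]
  exact le_of_tendsto (h.tendsto hl u).norm (Eventually.of_forall fun N =>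
    h.norm_katoSum_le hl N u)

variable [IsOrderedModule ℝ X]

theorem anti (h : IsKatoResolvent φ D a b r R F G) (hl : 0 < l) (hlm : l ≤ m) (u : X)
    (hu : 0 ≤ u) : G m u ≤ G l u :=
  le_of_tendsto_of_tendsto (h.tendsto (hl.trans_le hlm) u) (h.tendsto hl u)
    (Eventually.of_forall fun N => h.katoSum_anti hl hlm N u hu)

/-- On the cone both G and the powers of F grow as the parameter decreases, so the common parameter
`min l m` dominates. -/
theorem tendsto_apply_pow' (h : IsKatoResolvent φ D a b r R F G) (hl : 0 < l) (hm : 0 < m)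
    (v : X) : Tendsto (fun N => G l ((F m ^ N) v)) atTop (𝓝 0) := by
  refine tendsto_zero_of_nonneg (F := fun N => G l * F m ^ N) (fun v hv => ?_) v
  have hn : 0 < min l m := lt_min hl hm
  have h1 := (h.tendsto_apply_pow hn v).norm
  rw [norm_zero] at h1
  refine squeeze_zero_norm (fun N => ?_) h1
  refine norm_le_norm_of_eq_norm h.norm_eq (h.nonneg hl _ (h.F_pow_nonneg hm N hv)) ?_
  exact (h.anti hn (min_le_left _ _) _ (h.F_pow_nonneg hm N hv)).trans
    (map_le_map_of_nonneg (L := (G (min l m) : X →ₗ[ℝ] X)) (h.nonneg hn)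
      (h.F_pow_anti hn (min_le_right _ _) N hv))

/-- G_m v need not lie in `D`, so the identity is proved for the partial sums, with an error G_l
F_m^N v that vanishes in the limit. -/
theorem sub_eq (h : IsKatoResolvent φ D a b r R F G) (hl : 0 < l) (hm : 0 < m) (v : X) :
    G l v - G m v = (m - l) • G l (G m v) := by
  have h1 : ∀ N, G l v - G l ((F m ^ N) v) - katoSum R F m N v =
      (m - l) • G l (katoSum R F m N v) := by
    intro N
    obtain ⟨w, hw, hw'⟩ := h.exists_coe_eq_katoSum hm N v
    have h2 := h.apply_sub hl w
    have h3 : l • (w : X) - a w - b w = v - (F m ^ N) v - (m - l) • (w : X) := by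
      rw [← hw', sub_smul]; abel
    rw [h3, map_sub, map_sub, map_smul, hw] at h2
    nth_rewrite 1 [← h2]
    abel
  have h2 := ((tendsto_const_nhds (x := G l v)).sub (h.tendsto_apply_pow' hl hm v)).sub
    (h.tendsto hm v)
  rw [sub_zero] at h2
  refine tendsto_nhds_unique h2 ?_
  simp only [h1]
  exact (((G l).continuous.tendsto _).comp (h.tendsto hm v)).const_smul _

theorem isResolventFamily (h : IsKatoResolvent φ D a b r R F G) : IsResolventFamily G where
  sub_eq := h.sub_eq
  norm_le := h.norm_le
  dense := h.dense.mono fun w hw => ⟨_, h.apply_sub one_pos ⟨w, hw⟩⟩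

variable [CompleteSpace X]

/-- The minimal semigroup of a Kato pair. -/
theorem exists_semigroup (h : IsKatoResolvent φ D a b r R F G) :
    ∃ P : ℝ≥0 → X →L[ℝ] X, IsContractionSemigroup P ∧ (∀ t u, 0 ≤ u → 0 ≤ P t u) ∧
      (∀ t u, Tendsto (fun l => yosida G l t u) atTop (𝓝 (P t u))) ∧
      ∀ w : D, HasGenerator P w (a w + b w) := by
  obtain ⟨P, hP, hlim, hgen⟩ := h.isResolventFamily.exists_semigroup
  refine ⟨P, hP, fun t u hu => ?_, hlim, fun w => ?_⟩
  · refine ge_of_tendsto (hlim t u) ?_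
    filter_upwards [eventually_gt_atTop 0] with l hl
    exact yosida_nonneg (h.nonneg hl) t hu
  · have h1 := hgen ((1 : ℝ) • (w : X) - a w - b w)
    rw [h.apply_sub one_pos, one_smul] at h1
    convert h1 using 1
    abel

/-- The resolvent J_l of `Q` inverts l - a - b on `D`, so the N-th partial sum at u is J_l(u - F_l^N
u) ≤ J_l u. Thus G_l ≤ J_l, and the Yosida limits inherit the order. -/
theorem le_semigroup (h : IsKatoResolvent φ D a b r R F G) {P Q : ℝ≥0 → X →L[ℝ] X}
    (hP : ∀ t u, Tendsto (fun l => yosida G l t u) atTop (𝓝 (P t u)))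
    (hQ : IsContractionSemigroup Q) (hQpos : ∀ t u, 0 ≤ u → 0 ≤ Q t u)
    (hQgen : ∀ w : D, HasGenerator Q w (a w + b w)) (t : ℝ≥0) {u : X} (hu : 0 ≤ u) :
    P t u ≤ Q t u := by
  have hJ : ∀ l : ℝ, ∃ J : X →L[ℝ] X, 0 < l → ∀ u, J u = laplace Q l u := by
    intro l
    by_cases hl : 0 < l
    · exact (hQ.exists_laplace hl).imp fun J hJ _ => hJ
    · exact ⟨0, fun h => absurd h hl⟩
  choose J hJ using hJ
  have hJpos : ∀ l, 0 < l → ∀ u, 0 ≤ u → 0 ≤ J l u := fun l hl u hu => by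
    rw [hJ l hl]
    exact laplace_nonneg hQpos l hu
  have hle : ∀ l, 0 < l → ∀ u, 0 ≤ u → G l u ≤ J l u := by
    intro l hl u hu
    refine le_of_tendsto (h.tendsto hl u) (Eventually.of_forall fun N => ?_)
    obtain ⟨w, hw, hw'⟩ := h.exists_coe_eq_katoSum hl N u
    have h1 := hQ.laplace_eq_of_hasGenerator hl (hQgen w)
    rw [← sub_sub, hw', ← hJ l hl, map_sub, hw] at h1
    rw [← h1]
    exact sub_le_self _ (hJpos l hl _ (h.F_pow_nonneg hl N hu))
  refine le_of_tendsto_of_tendsto (hP t u) (hQ.tendsto_yosida hJ t u) ?_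
  filter_upwards [eventually_gt_atTop 0] with l hl
  exact yosida_le_yosida (h.nonneg hl) (hle l hl) t hu

end IsKatoResolvent

end Kato

/-! ### Strong stability and the resolvent near zero. -/

section Stability

variable {X : Type*} [NormedAddCommGroup X] [NormedSpace ℝ X] {T : ℝ≥0 → X →L[ℝ] X}

theorem IsContractionSemigroup.norm_antitone (hT : IsContractionSemigroup T) (u : X) :
    Antitone fun t => ‖T t u‖ := by
  intro s t hst
  have : T t u = T (t - s) (T s u) := by
    conv_lhs => rw [← tsub_add_cancel_of_le hst, hT.map_add]
    rfl
  simp only [this]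
  exact hT.norm_le _ _

variable [CompleteSpace X]

/-- Split the Laplace integral at t: the tail is a damped Laplace transform of T_t u, the head has
norm at most t‖u‖. -/
theorem IsContractionSemigroup.norm_smul_laplace_le (hT : IsContractionSemigroup T) {l : ℝ}
    (hl : 0 < l) (t : ℝ≥0) (u : X) : l * ‖laplace T l u‖ ≤ ‖T t u‖ + l * (t * ‖u‖) := by
  have h1 := hT.apply_laplace hl t u
  set I := ∫ s in (0 : ℝ)..t, Real.exp (-l * s) • T s.toNNReal u
  have h2 : laplace T l u = Real.exp (-(l * t)) • laplace T l (T t u) + I := by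
    rw [← hT.apply_laplace_eq_laplace_apply hl, h1, smul_smul, ← Real.exp_add, neg_add_cancel,
      Real.exp_zero, one_smul, sub_add_cancel]
  have hI : ‖I‖ ≤ t * ‖u‖ := by
    have := intervalIntegral.norm_integral_le_of_norm_le_const (a := 0) (b := (t : ℝ)) (C := ‖u‖)
      (f := fun s => Real.exp (-l * s) • T s.toNNReal u) fun s hs => by
        rw [Set.uIoc_of_le t.coe_nonneg] at hs
        refine (hT.norm_integrand_le l u s).trans (mul_le_of_le_one_left (norm_nonneg _) ?_)
        exact Real.exp_le_one_iff.2 (by nlinarith [hs.1])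
    rwa [sub_zero, abs_of_nonneg t.coe_nonneg, mul_comm] at this
  have h3 : ‖Real.exp (-(l * t)) • laplace T l (T t u)‖ ≤ l⁻¹ * ‖T t u‖ := by
    rw [norm_smul, Real.norm_of_nonneg (Real.exp_pos _).le]
    refine (mul_le_of_le_one_left (norm_nonneg _) ?_).trans (hT.norm_laplace_le hl _)
    exact Real.exp_le_one_iff.2 (neg_nonpos.2 (by positivity))
  have h4 : ‖laplace T l u‖ ≤ l⁻¹ * ‖T t u‖ + t * ‖u‖ := by
    rw [h2]
    exact (norm_add_le _ _).trans (add_le_add h3 hI)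
  calc l * ‖laplace T l u‖ ≤ l * (l⁻¹ * ‖T t u‖ + t * ‖u‖) :=
        mul_le_mul_of_nonneg_left h4 hl.le
    _ = _ := by rw [mul_add, mul_inv_cancel_left₀ hl.ne']

theorem IsContractionSemigroup.tendsto_smul_laplace (hT : IsContractionSemigroup T) {u : X}
    (hu : Tendsto (fun t => T t u) atTop (𝓝 0)) :
    Tendsto (fun l => l * ‖laplace T l u‖) (𝓝[>] 0) (𝓝 0) := by
  refine Metric.tendsto_nhds.2 fun ε hε => ?_
  obtain ⟨t, ht⟩ := (Metric.tendsto_nhds.1 hu (ε / 2) (by positivity)).exists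
  have h1 : Tendsto (fun l : ℝ => l * (t * ‖u‖)) (𝓝[>] 0) (𝓝 0) :=
    ((by fun_prop : Continuous fun l : ℝ => l * (t * ‖u‖)).tendsto' 0 0 (by simp)).mono_left
      nhdsWithin_le_nhds
  filter_upwards [h1.eventually (gt_mem_nhds (half_pos hε)), self_mem_nhdsWithin] with l hl1 hl
  have hl' : 0 < l := hl
  rw [dist_zero_right] at ht
  rw [dist_zero_right, Real.norm_of_nonneg (by positivity)]
  linarith [hT.norm_smul_laplace_le hl' t u]

theorem IsContractionSemigroup.le_map_laplace (hT : IsContractionSemigroup T) {φ : X →L[ℝ] ℝ}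
    {u : X} {c : ℝ} (hc : ∀ t, c ≤ φ (T t u)) {l : ℝ} (hl : 0 < l) :
    c ≤ l * φ (laplace T l u) := by
  have hint := hT.integrableOn hl u
  rw [laplace, ← ContinuousLinearMap.integral_comp_comm _ hint, mul_comm, ← div_le_iff₀ hl,
    div_eq_inv_mul, ← integral_exp_neg_mul hl, ← integral_mul_const]
  refine setIntegral_mono ((exp_neg_integrableOn_Ioi 0 hl).mul_const c)
    (φ.integrable_comp hint) fun t => ?_
  simp only [map_smul, smul_eq_mul]
  exact mul_le_mul_of_nonneg_left (hc _) (Real.exp_pos _).le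

variable [Lattice X] [IsOrderedAddMonoid X]

/-- The average of ‖T_t u‖ against the probability density l e^(-lt) is at least the infimum of this
decreasing function, which is its limit at infinity. -/
theorem IsContractionSemigroup.stronglyStable_iff (hT : IsContractionSemigroup T)
    (hpos : ∀ t u, 0 ≤ u → 0 ≤ T t u) {φ : X →L[ℝ] ℝ} (hφ : ∀ u, 0 ≤ u → φ u = ‖u‖)
    (hlap : ∀ l, 0 < l → ∀ u, 0 ≤ u → 0 ≤ laplace T l u) :
    StronglyStable T ↔
      ∀ u, 0 ≤ u → Tendsto (fun l => l * φ (laplace T l u)) (𝓝[>] 0) (𝓝 0) := by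
  constructor
  · intro h u hu
    refine (hT.tendsto_smul_laplace (h u)).congr' ?_
    filter_upwards [self_mem_nhdsWithin] with l hl
    rw [hφ _ (hlap l hl u hu)]
  · intro h
    refine tendsto_zero_of_nonneg fun u hu => ?_
    have hbdd : BddBelow (Set.range fun t => ‖T t u‖) :=
      ⟨0, by rintro _ ⟨t, rfl⟩; exact norm_nonneg _⟩
    have hlim := tendsto_atTop_ciInf (hT.norm_antitone u) hbdd
    have hle : ⨅ t, ‖T t u‖ ≤ 0 := by
      refine ge_of_tendsto (h u hu) ?_
      filter_upwards [self_mem_nhdsWithin] with l hl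
      refine hT.le_map_laplace (fun t => ?_) hl
      rw [hφ _ (hpos t u hu)]
      exact ciInf_le hbdd t
    rw [le_antisymm hle (le_ciInf fun t => norm_nonneg _)] at hlim
    exact tendsto_zero_iff_norm_tendsto_zero.2 hlim

end Stability

/-! ### The limit operator and mean ergodicity. -/

section Kato

variable {X : Type*} [NormedAddCommGroup X] [NormedSpace ℝ X] [Lattice X]
  {φ : X →L[ℝ] ℝ} {D : Submodule ℝ X} {a b : D →ₗ[ℝ] X}
  {r : ℝ → X →ₗ[ℝ] D} {R F : ℝ → X →L[ℝ] X} {l : ℝ}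

/-- A fixed vector loses no mass, so the balance identity forces R_l u = 0, and R_l is injective. -/
theorem IsKatoPair.eq_zero_of_F_eq (h : IsKatoPair φ D a b r R F) (hl : 0 < l) {u : X}
    (hu : 0 ≤ u) (hF : F l u = u) : u = 0 := by
  have h1 := h.map_F hl hu
  rw [hF] at h1
  have h2 : φ (R l u) = 0 := by
    have : l * φ (R l u) = 0 := by linarith
    exact (mul_eq_zero.1 this).resolve_left hl.ne'
  rw [h.norm_eq _ (h.R_nonneg hl u hu), norm_eq_zero, h.R_eq hl] at h2
  have h3 : r l u = 0 := Subtype.ext h2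
  rw [← h.right_inv hl u, h3]
  simp

variable [IsOrderedAddMonoid X] [HasSolidNorm X] [IsOrderedModule ℝ X] [CompleteSpace X]

theorem IsKatoPair.exists_limit (h : IsKatoPair φ D a b r R F) :
    ∃ K : X →L[ℝ] X, (∀ u, Tendsto (fun l => F l u) (𝓝[>] 0) (𝓝 (K u))) ∧
      (∀ u, 0 ≤ u → 0 ≤ K u) ∧ (∀ u, ‖K u‖ ≤ ‖u‖) ∧
      (∀ l, 0 < l → ∀ u, 0 ≤ u → F l u ≤ K u) ∧
      ∀ u, 0 ≤ u → Tendsto (fun l => l * φ (R l u)) (𝓝[>] 0) (𝓝 (φ u - φ (K u))) := by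
  have h1 : ∀ u, ∃ v, Tendsto (fun l => F l u) (𝓝[>] 0) (𝓝 v) := by
    refine exists_tendsto_of_nonneg fun u hu => ?_
    -- The substitution s = 1/l turns the limit at 0 into a monotone limit at infinity, taken from s
    -- = 1 on.
    obtain ⟨v, hv⟩ := exists_tendsto_of_monotone h.norm_eq (f := fun s : ℝ => F s⁻¹ u) (C := φ u)
      1 (fun i j hi hij => h.F_anti (inv_pos.2 (by linarith))
        (inv_anti₀ (by linarith) hij) u hu)
      (fun i hi => h.map_F_le (inv_pos.2 (by linarith)) hu)
    refine ⟨v, (hv.comp tendsto_inv_nhdsGT_zero).congr fun l => ?_⟩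
    simp
  choose f hf using h1
  obtain ⟨K, hK, hKn⟩ := exists_clm_of_tendsto hf (by
    filter_upwards [self_mem_nhdsWithin] with l hl using h.norm_F_le hl)
  have hlim : ∀ u, Tendsto (fun l => F l u) (𝓝[>] 0) (𝓝 (K u)) := fun u => by
    rw [hK]; exact hf u
  have hFK : ∀ l, 0 < l → ∀ u, 0 ≤ u → F l u ≤ K u := by
    intro l hl u hu
    refine ge_of_tendsto (hlim u) ?_
    filter_upwards [Ioc_mem_nhdsGT hl] with s hs using h.F_anti hs.1 hs.2 u hu
  refine ⟨K, hlim, fun u hu => (h.F_nonneg one_pos u hu).trans (hFK 1 one_pos u hu), hKn, hFK,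
    fun u hu => ?_⟩
  refine (((φ.continuous.tendsto _).comp (hlim u)).const_sub (φ u)).congr' ?_
  filter_upwards [self_mem_nhdsWithin] with l hl
  rw [Function.comp_apply, h.map_F hl hu, sub_sub_cancel]

/-- The powers of `F l` vanish in the limit when `F l` is dominated by a mean ergodic positive
contraction. -/
theorem IsKatoPair.tendsto_map_pow (h : IsKatoPair φ D a b r R F) (hl : 0 < l) {K : X →L[ℝ] X}
    (hKn : ∀ u, ‖K u‖ ≤ ‖u‖) (hFK : ∀ u, 0 ≤ u → F l u ≤ K u) (hK : MeanErgodic K) (u : X)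
    (hu : 0 ≤ u) : Tendsto (fun n => φ ((F l ^ n) u)) atTop (𝓝 0) := by
  have hKpos : ∀ u, 0 ≤ u → 0 ≤ K u := fun u hu => (h.F_nonneg hl u hu).trans (hFK u hu)
  have hmono : ∀ (n : ℕ) {x y : X}, x ≤ y → (F l ^ n) x ≤ (F l ^ n) y := fun n x y hxy =>
    map_le_map_of_nonneg (L := ((F l ^ n : X →L[ℝ] X) : X →ₗ[ℝ] X))
      (fun v hv => h.F_pow_nonneg hl n hv) hxy
  obtain ⟨f, hf⟩ := hK u
  set c : ℕ → X := fun N => (N : ℝ)⁻¹ • ∑ n ∈ Finset.range N, (K ^ n) u with hc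
  have hf0 : 0 ≤ f := ge_of_tendsto' hf fun N =>
    smul_nonneg (by positivity) (Finset.sum_nonneg fun n _ => pow_apply_nonneg hKpos n hu)
  -- K c_N - c_N telescopes to (K^N u - u) / N, of norm at most 2‖u‖ / N.
  have hKf : K f = f := by
    have h1 : Tendsto (fun N => K (c N) - c N) atTop (𝓝 (K f - f)) :=
      ((K.continuous.tendsto f).comp hf).sub hf
    have h2 : Tendsto (fun N => K (c N) - c N) atTop (𝓝 0) := by
      have h3 : Tendsto (fun N : ℕ => (N : ℝ)⁻¹ * (2 * ‖u‖)) atTop (𝓝 0) := by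
        simpa using (tendsto_inv_atTop_nhds_zero_nat (𝕜 := ℝ)).mul_const (2 * ‖u‖)
      refine squeeze_zero_norm (fun N => ?_) h3
      have h4 : K (c N) - c N = (N : ℝ)⁻¹ • ((K ^ N) u - u) := by
        rw [hc]
        simp only
        rw [map_smul, ← smul_sub, map_sum, ← Finset.sum_sub_distrib]
        congr 1
        refine Eq.trans (Finset.sum_congr rfl fun n _ => ?_)
          (Finset.sum_range_sub (fun n => (K ^ n) u) N)
        rw [pow_succ']; rfl
      have h5 : ∀ n : ℕ, ‖(K ^ n) u‖ ≤ ‖u‖ := by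
        intro n
        induction n with
        | zero => simp
        | succ n ih => rw [pow_succ']; exact (hKn _).trans ih
      rw [h4, norm_smul, norm_inv, Real.norm_natCast]
      refine mul_le_mul_of_nonneg_left ((norm_sub_le _ _).trans ?_) (by positivity)
      linarith [h5 N]
    exact sub_eq_zero.1 (tendsto_nhds_unique h1 h2)
  -- F f ≤ K f = f makes the powers decrease; their limit is a positive fixed vector of F, hence 0.
  have hpowf : Tendsto (fun n => (F l ^ n) f) atTop (𝓝 0) := by
    have hanti : Antitone fun n => (F l ^ n) f := antitone_nat_of_succ_le fun n => by
      rw [pow_succ]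
      exact hmono n ((hFK f hf0).trans_eq hKf)
    obtain ⟨g, hg⟩ := exists_tendsto_of_antitone h.norm_eq hanti
      fun n => h.F_pow_nonneg hl n hf0
    have hg0 : 0 ≤ g := ge_of_tendsto' hg fun n => h.F_pow_nonneg hl n hf0
    have hFg : F l g = g := by
      refine tendsto_nhds_unique (((F l).continuous.tendsto g).comp hg) ?_
      refine ((tendsto_add_atTop_iff_nat 1).2 hg).congr fun n => ?_
      rw [pow_succ']; rfl
    rwa [h.eq_zero_of_F_eq hl hg0 hFg] at hg
  have hanti : Antitone fun n => φ ((F l ^ n) u) := antitone_nat_of_succ_le fun n => by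
    rw [pow_succ']
    exact h.map_F_le hl (h.F_pow_nonneg hl n hu)
  have hbdd : BddBelow (Set.range fun n => φ ((F l ^ n) u)) :=
    ⟨0, by rintro _ ⟨n, rfl⟩; exact map_nonneg_of_eq_norm h.norm_eq (h.F_pow_nonneg hl n hu)⟩
  have hlim := tendsto_atTop_ciInf hanti hbdd
  set L := ⨅ n, φ ((F l ^ n) u) with hL
  have hL0 : 0 ≤ L :=
    le_ciInf fun n => map_nonneg_of_eq_norm h.norm_eq (h.F_pow_nonneg hl n hu)
  -- F^(n+k) u ≤ F^n K^k u. Averaging over k with n fixed then replaces K^k u by f.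
  have hLn : ∀ n k, L ≤ φ ((F l ^ n) ((K ^ k) u)) := by
    intro n k
    refine (ciInf_le hbdd (n + k)).trans ?_
    simp only [pow_add]
    exact map_le_map_of_eq_norm h.norm_eq
      (hmono n (pow_apply_le_pow_apply (h.F_nonneg hl) hFK k hu))
  have hLf : ∀ n, L ≤ φ ((F l ^ n) f) := by
    intro n
    refine ge_of_tendsto
      ((φ.continuous.tendsto _).comp (((F l ^ n).continuous.tendsto f).comp hf)) ?_
    filter_upwards [eventually_gt_atTop 0] with N hN
    have hN' : (0 : ℝ) < N := by exact_mod_cast hN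
    simp only [hc, Function.comp_apply, map_smul, map_sum, smul_eq_mul]
    rw [inv_mul_eq_div, le_div_iff₀ hN', mul_comm]
    calc (N : ℝ) * L = ∑ _k ∈ Finset.range N, L := by simp
      _ ≤ _ := Finset.sum_le_sum fun k _ => hLn n k
  have hL1 : L ≤ φ 0 :=
    ge_of_tendsto' ((φ.continuous.tendsto _).comp hpowf) hLf
  rw [map_zero] at hL1
  rwa [le_antisymm hL1 hL0] at hlim

end Kato

/-! ### The integral on L¹ as the additive functional. -/

section LOne

variable {E : Type*} [MeasurableSpace E] {m : Measure E}

theorem isOrderedModule_Lp : IsOrderedModule ℝ (Lp ℝ 1 m) := by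
  refine IsOrderedModule.of_smul_nonneg fun c hc u hu => ?_
  rw [← Lp.coeFn_nonneg] at hu ⊢
  filter_upwards [hu, Lp.coeFn_smul c u] with x hx hx'
  rw [hx']
  exact mul_nonneg hc hx

theorem integralCLM_eq_integral (u : Lp ℝ 1 m) : L1.integralCLM u = ∫ x, u x ∂m := by
  rw [← L1.integral_eq, L1.integral_eq_integral]

theorem integralCLM_eq_norm (u : Lp ℝ 1 m) (hu : 0 ≤ u) : L1.integralCLM u = ‖u‖ := by
  rw [integralCLM_eq_integral, L1.norm_eq_integral_norm]
  refine integral_congr_ae ?_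
  filter_upwards [(Lp.coeFn_nonneg u).2 hu] with x hx
  exact (Real.norm_of_nonneg hx).symm

theorem isStochastic_iff {T : Lp ℝ 1 m →L[ℝ] Lp ℝ 1 m} (hT : ∀ u, 0 ≤ u → 0 ≤ T u) :
    IsStochastic T ↔ ∀ u, 0 ≤ u → L1.integralCLM (T u) = L1.integralCLM u := by
  have := isOrderedModule_Lp (m := m)
  constructor
  · intro h u hu
    rw [integralCLM_eq_norm u hu, integralCLM_eq_norm _ (hT u hu)]
    rcases eq_or_ne u 0 with rfl | hne
    · simp
    have hn : 0 < ‖u‖ := norm_pos_iff.2 hne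
    have h1 := (h (‖u‖⁻¹ • u) ⟨smul_nonneg (by positivity) hu, by
      rw [norm_smul, norm_inv, norm_norm, inv_mul_cancel₀ hn.ne']⟩).2
    rw [map_smul, norm_smul, norm_inv, norm_norm, inv_mul_eq_one₀ hn.ne'] at h1
    exact h1.symm
  · rintro h u ⟨hu, hu1⟩
    refine ⟨hT u hu, ?_⟩
    rw [← integralCLM_eq_norm _ (hT u hu), h u hu, integralCLM_eq_norm u hu, hu1]

theorem IsSubstochasticSemigroup.isContractionSemigroup {T : ℝ≥0 → Lp ℝ 1 m →L[ℝ] Lp ℝ 1 m}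
    (hT : IsSubstochasticSemigroup T) : IsContractionSemigroup T :=
  ⟨hT.1, fun t => (hT.2 t).2⟩

/-- The sum lives on the intersection of the domains, which here is the domain of A. -/
theorem add_le_generator_iff {A B : Lp ℝ 1 m →ₗ.[ℝ] Lp ℝ 1 m} (hAB : A.domain ≤ B.domain)
    {T : ℝ≥0 → Lp ℝ 1 m →L[ℝ] Lp ℝ 1 m} : A + B ≤ generator T ↔
      ∀ w : A.domain, HasGenerator T w (A w + B (Submodule.inclusion hAB w)) := by
  constructor
  · rintro ⟨h1, h2⟩ w
    have hw : (w : Lp ℝ 1 m) ∈ (A + B).domain := ⟨w.2, hAB w.2⟩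
    have h3 := hasGenerator_generator (T := T) ⟨w, h1 hw⟩
    rw [← h2 (x := ⟨w, hw⟩) rfl] at h3
    exact h3
  · intro h
    have hdom : ∀ w, (hw : w ∈ (A + B).domain) → HasGenerator T w ((A + B) ⟨w, hw⟩) :=
      fun w hw => h ⟨w, hw.1⟩
    refine ⟨fun w hw => ⟨_, hdom w hw⟩, ?_⟩
    rintro ⟨x, hx⟩ ⟨y, hy⟩ (rfl : x = y)
    exact (hdom x hx).unique (hasGenerator_generator ⟨x, hy⟩)

end LOne

end SubstochasticSemigroup

end

/-! ### The theorem for substochastic semigroups. -/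

open SubstochasticSemigroup

theorem theorem3p4 {E : Type*} [MeasurableSpace E] (m : Measure E) [SigmaFinite m]
    (S : ℝ≥0 → Lp ℝ 1 m →L[ℝ] Lp ℝ 1 m) (A B : Lp ℝ 1 m →ₗ.[ℝ] Lp ℝ 1 m)
    (hS : IsSubstochasticSemigroup S) (hA : generator S = A)
    (hAB : A.domain ≤ B.domain)
    (hBpos : ∀ u : A.domain, 0 ≤ (u : Lp ℝ 1 m) → 0 ≤ B (Submodule.inclusion hAB u))
    (hzero : ∀ u : A.domain, 0 ≤ (u : Lp ℝ 1 m) →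
      ∫ x, (A u + B (Submodule.inclusion hAB u) : Lp ℝ 1 m) x ∂m = 0) :
    (∀ lam : ℝ, 0 < lam → InResolventSet A lam) ∧
    (∃! P : ℝ≥0 → Lp ℝ 1 m →L[ℝ] Lp ℝ 1 m, IsMinimalSemigroup A B P) ∧
    ∃ K : Lp ℝ 1 m →L[ℝ] Lp ℝ 1 m,
      (∀ u : Lp ℝ 1 m,
        Tendsto (fun lam : ℝ => perturbResolvent A B hAB lam u) (𝓝[>] 0) (𝓝 (K u))) ∧
      IsPositiveContraction K ∧
      (IsStochastic K ↔ StronglyStable S) ∧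
      (MeanErgodic K → ∀ P : ℝ≥0 → Lp ℝ 1 m →L[ℝ] Lp ℝ 1 m,
        IsMinimalSemigroup A B P → IsStochasticSemigroup P) := by
  have := isOrderedModule_Lp (m := m)
  have hS' := hS.isContractionSemigroup
  have hSpos : ∀ t u, 0 ≤ u → 0 ≤ S t u := fun t => (hS.2 t).1
  have hres : ∀ lam : ℝ, 0 < lam → InResolventSet A lam := fun lam hl => by
    rw [← hA]; exact hS'.inResolventSet hl
  have hlap : ∀ l, 0 < l → ∀ u, (resolventMap A l u : Lp ℝ 1 m) = laplace S l u :=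
    fun l hl u => by rw [← hA]; exact hS'.resolventMap_eq_laplace hl u
  have hlappos : ∀ l, 0 < l → ∀ u, 0 ≤ u → 0 ≤ laplace S l u := fun l _ u hu =>
    laplace_nonneg hSpos l hu
  set φ : Lp ℝ 1 m →L[ℝ] ℝ := L1.integralCLM with hφdef
  set b : A.domain →ₗ[ℝ] Lp ℝ 1 m := B.toFun ∘ₗ Submodule.inclusion hAB with hb
  have hzero' : ∀ w : A.domain, 0 ≤ (w : Lp ℝ 1 m) → φ (A w + b w) = 0 := fun w hw => by
    rw [hφdef, integralCLM_eq_integral]; exact hzero w hw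
  have hR : ∀ l : ℝ, ∃ R : Lp ℝ 1 m →L[ℝ] Lp ℝ 1 m, 0 < l → ∀ u, R u = resolventMap A l u := by
    intro l
    by_cases hl : 0 < l
    · obtain ⟨R, hR⟩ := hS'.exists_laplace hl
      exact ⟨R, fun _ u => by rw [hR, hlap l hl]⟩
    · exact ⟨0, fun h => absurd h hl⟩
  have hF : ∀ l : ℝ, ∃ F : Lp ℝ 1 m →L[ℝ] Lp ℝ 1 m,
      0 < l → ∀ u, F u = perturbResolvent A B hAB l u := by
    intro l
    by_cases hl : 0 < l
    swap
    · exact ⟨0, fun h => absurd h hl⟩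
    have hpos : ∀ u, 0 ≤ u → 0 ≤ perturbResolvent A B hAB l u := fun u hu =>
      hBpos _ (by rw [hlap l hl]; exact hlappos l hl u hu)
    -- B is not assumed closed or bounded: the bound 1 comes from positivity and the balance
    -- identity on the cone.
    refine ⟨LinearMap.mkContinuous (perturbResolvent A B hAB l) 1
      (norm_map_le_of_nonneg hpos fun u hu => ?_), fun _ u => rfl⟩
    have h0 : 0 ≤ (resolventMap A l u : Lp ℝ 1 m) := by
      rw [hlap l hl]; exact hlappos l hl u hu
    have h1 := hzero' (resolventMap A l u) h0
    have h2 := congrArg φ (shifted_resolventMap (hres l hl) u)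
    have h3 := mul_nonneg hl.le (map_nonneg_of_eq_norm integralCLM_eq_norm h0)
    rw [map_sub, map_smul, smul_eq_mul] at h2
    rw [map_add] at h1
    rw [one_mul, ← integralCLM_eq_norm u hu, ← integralCLM_eq_norm _ (hpos u hu)]
    change φ (b (resolventMap A l u)) ≤ φ u
    linarith
  choose R hR using hR
  choose F hF using hF
  have hkato : IsKatoPair φ A.domain A.toFun b (resolventMap A) R F :=
    { norm_eq := integralCLM_eq_norm
      R_eq := fun hl u => hR _ hl u
      F_eq := fun hl u => hF _ hl u
      right_inv := fun hl u => shifted_resolventMap (hres _ hl) u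
      left_inv := fun hl w => resolventMap_shifted (hres _ hl) w
      R_nonneg := fun hl u hu => by
        rw [hR _ hl, hlap _ hl]; exact hlappos _ hl u hu
      b_nonneg := hBpos
      map_add_eq_zero := hzero'
      dense := fun u => closure_mono (by
        rintro _ ⟨v, rfl⟩
        rw [← hlap 1 one_pos]
        exact (resolventMap A 1 v).2) (hS'.mem_closure_range_laplace one_pos u) }
  obtain ⟨G, hG⟩ := hkato.exists_katoResolvent
  have hmin : IsKatoResolvent φ A.domain A.toFun b (resolventMap A) R F G :=
    ⟨hkato, fun hl => hG _ hl⟩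
  obtain ⟨P, hP, hPpos, hPlim, hPgen⟩ := hmin.exists_semigroup
  have hPmin : IsMinimalSemigroup A B P := by
    refine ⟨⟨⟨hP.toIsC0Semigroup, fun t => ⟨hPpos t, hP.norm_le t⟩⟩,
      (add_le_generator_iff hAB).2 hPgen⟩, fun Q hQ t u hu => ?_⟩
    exact hmin.le_semigroup hPlim hQ.1.isContractionSemigroup (fun t => (hQ.1.2 t).1)
      ((add_le_generator_iff hAB).1 hQ.2) t hu
  have huniq : ∀ Q, IsMinimalSemigroup A B Q → Q = P := fun Q hQ => by
    funext t
    exact eq_of_eqOn_nonneg fun u hu =>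
      le_antisymm (hQ.2 P hPmin.1 t u hu) (hPmin.2 Q hQ.1 t u hu)
  obtain ⟨K, hKlim, hKpos, hKn, hFK, hKR⟩ := hkato.exists_limit
  refine ⟨hres, ⟨P, hPmin, huniq⟩, K, fun u => ?_, ⟨hKpos, hKn⟩, ?_, fun hK Q hQ => ?_⟩
  · refine (hKlim u).congr' ?_
    filter_upwards [self_mem_nhdsWithin] with l hl using hF l hl u
  · rw [isStochastic_iff hKpos,
      hS'.stronglyStable_iff hSpos (φ := φ) integralCLM_eq_norm hlappos]
    -- For each u ≥ 0 the limit of l φ(R_l u) is φ(u) - φ(Ku), so the two conditions agree vector by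
    -- vector.
    refine forall₂_congr fun u hu => ?_
    have h1 : Tendsto (fun l => l * φ (laplace S l u)) (𝓝[>] 0) (𝓝 (φ u - φ (K u))) := by
      refine (hKR u hu).congr' ?_
      filter_upwards [self_mem_nhdsWithin] with l hl
      rw [hR l hl, hlap l hl]
    constructor
    · intro h
      rwa [h, sub_self] at h1
    · intro h
      exact (sub_eq_zero.1 (tendsto_nhds_unique h1 h)).symm
  · rw [huniq Q hQ]
    refine ⟨hP.toIsC0Semigroup, fun t => (isStochastic_iff (hPpos t)).2 fun u _ => ?_⟩
    exact hmin.map_semigroup_eq hPlim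
      (fun l hl => hkato.tendsto_map_pow hl hKn (hFK l hl) hK) t u
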